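/- Let $\mathcal{A}$ be a finite set with the discrete topology, let $(T\omega)(n)=\omega(n+1)$ be the shift on $\mathcal{A}^{\mathbb{Z}}$, and let $\Omega\subseteq\mathcal{A}^{\mathbb{Z}}$ be a minimal subshift, that is, a nonempty closed set with $T(\Omega)=\Omega$ in which every orbit $\{T^n\omega : n\in\mathbb{Z}\}$ is dense. For every $a\in\mathcal{A}$ let $\ell_a>0$ and a real-valued function $f_a\in L^2(0,\ell_a)$ be given. For $\omega\in\Omega$ put $x_n=\sum_{0\le k<n}\ell_{\omega_k}$ for $n\ge 0$ and $x_n=-\sum_{n\le k<0}\ell_{\omega_k}$ for $n<0$, and let $V_\omega:\mathbb{R}\to\mathbb{R}$ be the concatenated potential $V_\omega(x)=f_{\omega_n}(x-x_n)$ for $x\in[x_n,x_{n+1})$, $n\in\mathbb{Z}$. For $E\in\mathbb{R}$ let $A_{E,\omega}(x,x_0)\in\mathrm{SL}(2,\mathbb{R})$ be the transfer matrix of $-y''+V_\omega y=Ey$, that is, the locally absolutely continuous (in $x$) solution of $$\frac{\partial A_{E,\omega}}{\partial x}(x,x_0)=\begin{pmatrix}0&V_\omega(x)-E\\1&0\end{pmatrix}A_{E,\omega}(x,x_0)\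 \text{ for a.e. } x,\qquad A_{E,\omega}(x_0,x_0)=\begin{pmatrix}1&0\\0&1\end{pmatrix},$$ so that $A_{E,\omega}(x,x_0)\,(y'(x_0),y(x_0))^{\top}=(y'(x),y(x))^{\top}$ for every solution $y$. Suppose that $\Omega$ satisfies the Boshernitzan condition (B): there is a $T$-ergodic Borel probability measure $\nu$ on $\Omega$ with $$\limsup_{n\to\infty}\Bigl(\min_{w\in\mathcal{W}_\Omega(n)} n\cdot\nu([w])\Bigr)>0,$$ where $\mathcal{W}_\Omega(n)$ is the set of words of length $n$ that occur in elements of $\Omega$ and $[w]=\{\omega\in\Omega:\omega_0\cdots\omega_{n-1}=w\}$. Let $\mu$ be any $T$-ergodic Borel probability measure on $\Omega$. Then for every $E\in\mathbb{R}$ the Lyapunov exponent $L(E)$ exists, that is, there is a constant $L(E)$ with $$L(E)=\lim_{x\to\infty}\frac1x\log\|A_{E,\omega}(x,0)\|\quad\text{for }\mu\text{-almost every }\omega\in\Omega,$$ and the set $\mathcal{Z}=\{E\in\mathbb{R}:L(E)=0\}$ satisfies $$\mathcal{Z}=\mathbb{R}\setminus\mathcal{UH},$$ where $\mathcal{UH}$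 is the set of all $E\in\mathbb{R}$ for which there are constants $C,\gamma>0$ such that $\|A_{E,\omega}(x,0)\|\ge Ce^{\gamma|x|}$ for all $\omega\in\Omega$ and all $x\in\mathbb{R}$. -/

import Mathlib

open MeasureTheory Filter Topology
open scoped ENNReal

namespace ContinuumSubshift

open SymbolicDynamics.FullShift

/-- A subshift `Ω ⊆ 𝒜^ℤ` is minimal if it is nonempty and every two-sided orbit
`{Tⁿ ω : n ∈ ℤ}` of the shift `(T ω)(k) = ω (k + 1)` is dense in it. -/
def IsMinimal {𝒜 : Type*} [TopologicalSpace 𝒜] (Ω : Subshift 𝒜 ℤ) : Prop :=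
  Ω.carrier.Nonempty ∧
    ∀ ω ∈ Ω.carrier, Ω.carrier ⊆ closure (Set.range fun n : ℤ => shift n ω)

/-- `μ` is a `T`-ergodic (invariant Borel) probability measure on the subshift `Ω`; it is
regarded as a measure on the full shift which is carried by `Ω`. -/
structure IsErgodicMeasure {𝒜 : Type*} [TopologicalSpace 𝒜] [MeasurableSpace 𝒜]
    (Ω : Subshift 𝒜 ℤ) (μ : Measure (ℤ → 𝒜)) : Prop where
  isProbabilityMeasure : IsProbabilityMeasure μ
  ergodic : Ergodic (shift (1 : ℤ)) μ
  carrier_compl : μ Ω.carrierᶜ = 0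

/-- The set of words of length `n` that occur in elements of `Ω`. -/
def words {𝒜 : Type*} [TopologicalSpace 𝒜] (Ω : Subshift 𝒜 ℤ) (n : ℕ) : Set (Fin n → 𝒜) :=
  {w | ∃ ω ∈ Ω.carrier, ∃ k : ℤ, ∀ i : Fin n, ω (k + (i : ℤ)) = w i}

/-- The cylinder set `[w]` of all `ω` with `ω 0 ω 1 … ω (n - 1) = w`. -/
def wordCylinder {𝒜 : Type*} {n : ℕ} (w : Fin n → 𝒜) : Set (ℤ → 𝒜) :=
  {ω | ∀ i : Fin n, ω (i : ℤ) = w i}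

/-- The Boshernitzan condition (B): there is a `T`-ergodic measure `μ` on `Ω` with
`limsup_{n → ∞} min_{w ∈ 𝒲_Ω(n)} n · μ([w]) > 0`. The upper limit is taken in `[0, ∞]`, since
the sequence is unbounded if `Ω` is finite. -/
def ConditionB {𝒜 : Type*} [TopologicalSpace 𝒜] [MeasurableSpace 𝒜]
    (Ω : Subshift 𝒜 ℤ) : Prop :=
  ∃ μ : Measure (ℤ → 𝒜), IsErgodicMeasure Ω μ ∧
    0 < limsup (fun n : ℕ => ⨅ w ∈ words Ω n, (n : ℝ≥0∞) * μ (wordCylinder w)) atTop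

/-- The local potential pieces: for every letter `a` a length `ℓ_a > 0` and a real function
`f_a ∈ L²(0, ℓ_a)`. -/
structure Pieces (𝒜 : Type*) where
  length : 𝒜 → ℝ
  length_pos : ∀ a, 0 < length a
  piece : 𝒜 → ℝ → ℝ
  memLp_piece : ∀ a, MemLp (piece a) 2 (volume.restrict (Set.Ioo 0 (length a)))

/-- The left end point `x_n` of the interval that carries the `n`-th letter of `ω`:
`x_n = ∑_{0 ≤ k < n} ℓ_{ω_k}` for `n ≥ 0` and `x_n = -∑_{n ≤ k < 0} ℓ_{ω_k}` for `n < 0`. -/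
noncomputable def leftEnd {𝒜 : Type*} (P : Pieces 𝒜) (ω : ℤ → 𝒜) (n : ℤ) : ℝ :=
  ∑ k ∈ Finset.Ico 0 n, P.length (ω k) - ∑ k ∈ Finset.Ico n 0, P.length (ω k)

/-- The concatenated potential `V_ω`, equal to `f_{ω_n}(x - x_n)` for `x ∈ [x_n, x_{n+1})`.
These intervals partition the line, so at each `x` exactly one term of the sum is relevant. -/
noncomputable def potential {𝒜 : Type*} (P : Pieces 𝒜) (ω : ℤ → 𝒜) (x : ℝ) : ℝ :=
  ∑ᶠ n : ℤ, (Set.Ico (leftEnd P ω n) (leftEnd P ω (n + 1))).indicator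
    (fun x => P.piece (ω n) (x - leftEnd P ω n)) x

/-- The coefficient matrix of `-y'' + V y = E y`, written as a first order system for the
vector `(y', y)`. -/
def coeffMatrix (V : ℝ → ℝ) (E x : ℝ) : Matrix (Fin 2) (Fin 2) ℝ :=
  !![0, V x - E; 1, 0]

/-- `A` is the (Carathéodory, i.e. locally absolutely continuous) solution of
`A' = coeffMatrix V E · A` almost everywhere, `A x₀ = 1`, stated in the equivalent integrated
form. -/
def IsTransferMatrix (V : ℝ → ℝ) (E x₀ : ℝ) (A : ℝ → Matrix (Fin 2) (Fin 2) ℝ) : Prop :=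
  Continuous A ∧
    ∀ x i j, A x i j =
      (1 : Matrix (Fin 2) (Fin 2) ℝ) i j + ∫ s in x₀..x, (coeffMatrix V E s * A s) i j

open Classical in
/-- The transfer matrix `A_{E,ω}(x, x₀)`. As `V_ω` is locally integrable, `IsTransferMatrix`
has exactly one solution, so the fallback value is never used. -/
noncomputable def transferMatrix {𝒜 : Type*} (P : Pieces 𝒜) (E : ℝ) (ω : ℤ → 𝒜)
    (x x₀ : ℝ) : Matrix (Fin 2) (Fin 2) ℝ :=
  if h : ∃ A, IsTransferMatrix (potential P ω) E x₀ A then h.choose x else 1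

/-- The operator norm of a `2 × 2` matrix acting on the Euclidean plane. -/
noncomputable def opNorm (M : Matrix (Fin 2) (Fin 2) ℝ) : ℝ :=
  ‖Matrix.toEuclideanCLM (n := Fin 2) (𝕜 := ℝ) M‖

/-- `L` is the Lyapunov exponent at energy `E` with respect to `μ`: for `μ`-almost every `ω`,
`lim_{x → ∞} (1 / x) log ‖A_{E,ω}(x, 0)‖ = L`. -/
def HasLyapunovExponent {𝒜 : Type*} [MeasurableSpace 𝒜] (P : Pieces 𝒜)
    (μ : Measure (ℤ → 𝒜)) (E L : ℝ) : Prop :=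
  ∀ᵐ ω ∂μ, Tendsto (fun x : ℝ => 1 / x * Real.log (opNorm (transferMatrix P E ω x 0)))
    atTop (𝓝 L)

open Classical in
/-- The Lyapunov exponent `L(E)` (with a fallback value where there is none). -/
noncomputable def lyapunovExponent {𝒜 : Type*} [MeasurableSpace 𝒜] (P : Pieces 𝒜)
    (μ : Measure (ℤ → 𝒜)) (E : ℝ) : ℝ :=
  if h : ∃ L, HasLyapunovExponent P μ E L then h.choose else 0

/-- The set `𝒵` of energies at which the Lyapunov exponent vanishes. -/
def zeroSet {𝒜 : Type*} [MeasurableSpace 𝒜] (P : Pieces 𝒜) (μ : Measure (ℤ → 𝒜)) : Set ℝ :=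
  {E | lyapunovExponent P μ E = 0}

/-- The set `𝒰ℋ` of uniformly hyperbolic energies: the transfer matrices grow exponentially in
`|x|`, with constants that are uniform on `Ω`. -/
def uniformlyHyperbolic {𝒜 : Type*} [TopologicalSpace 𝒜] (P : Pieces 𝒜)
    (Ω : Subshift 𝒜 ℤ) : Set ℝ :=
  {E | ∃ C > 0, ∃ γ > 0, ∀ ω ∈ Ω.carrier, ∀ x : ℝ,
    C * Real.exp (γ * |x|) ≤ opNorm (transferMatrix P E ω x 0)}

end ContinuumSubshift

/-!
Everything is reduced to products of `SL(2, ℝ)` matrices along the sequence of letters. Let `M a`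
be the transfer matrix across one letter `a`; then `A_{E,ω}(x_n, 0) = M (ω (n-1)) ⋯ M (ω 0)`, and
between two consecutive points `x_n` the norm changes by a bounded factor only. The heart of the
proof is that, under the Boshernitzan condition, `log ‖M (ω (n-1)) ⋯ M (ω 0)‖ / n` converges to a
number `Λ ≥ 0` *uniformly* in `ω ∈ Ω` (`exists_uniform_logCocycle`). Applied to the diagonal
matrices `diag (e^{ℓ_a}, e^{-ℓ_a})` the same theorem gives the uniform convergence of `x_n / n` to
a mean length `s > 0`. Hence `L(E) = Λ / s` is the exponential growth rate for *every* `ω ∈ Ω` (so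
the choice of `μ` does not matter), with errors uniform in `ω`. If `L(E) > 0`, this uniformity is
uniform hyperbolicity; if `L(E) = 0`, it excludes exponential growth.

The uniform convergence rests on three facts.

* `IsSubadditiveProcess.exists_tendsto_measureReal`: for an ergodic measure a bounded subadditive
  process divided by `n` converges in measure. This weak form of Kingman's theorem follows from
  von Neumann's mean ergodic theorem and Fekete's lemma.
* `abs_logCocycle_sub_le_of_isGoodScale`: if all words of length `n` have measure at least `c / n`
  for the measure `ν` of condition (B), and `n` is large, then *all* words of length `n` have norm
  `exp (n (Λ ± δ))`. Indeed the logarithm of the norm changes by a bounded amount when a window is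
  moved by one letter. By minimality a deviating window can be moved to a typical one, and on the
  way it runs through at least `const * δ * n` different words with intermediate values, whose
  cylinders have total measure at least `const * c * δ`, against convergence in measure.
* `mul_le_logCocycle_mul`: condition (B) provides such estimates at lengths `l` and `2 * l`
  simultaneously, for arbitrarily large `l`. If `Λ > 0`, consecutive blocks of length `l` then
  hardly cancel, and a form of the avalanche principle (`pow_le_norm_orderedProd`) propagates the
  lower bound to all lengths. It is proved by approximating one matrix of a product by a matrix of
  rank one, for which norms are multiplicative.

Mathlib has no existence theory for linear differential equations with coefficients that are only
integrable. It is supplied here in a Banach algebra, by a contraction in a norm with an exponential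
weight; the determinant of a transfer matrix is constant because it is absolutely continuous with
derivative zero almost everywhere.
-/

namespace ContinuumSubshift

open SymbolicDynamics.FullShift
open scoped Matrix.Norms.Frobenius

/-- A real `2 × 2` matrix as an operator on the Euclidean plane. The operators form a Banach
algebra, so that matrix-valued integrals can be taken there. -/
local notation "toCLM" => Matrix.toEuclideanCLM (n := Fin 2) (𝕜 := ℝ)

/-! ### Norms of products of unimodular matrices -/

theorem frobenius_norm_sq_fin_two (A : Matrix (Fin 2) (Fin 2) ℝ) :
    ‖A‖ ^ 2 = A 0 0 ^ 2 + A 0 1 ^ 2 + A 1 0 ^ 2 + A 1 1 ^ 2 := by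
  rw [Matrix.frobenius_norm_def, ← Real.sqrt_eq_rpow, Real.sq_sqrt (by positivity)]
  simp [Fin.sum_univ_two]
  ring

theorem two_le_norm_sq_of_det_eq_one {A : Matrix (Fin 2) (Fin 2) ℝ} (hA : A.det = 1) :
    2 ≤ ‖A‖ ^ 2 := by
  rw [Matrix.det_fin_two] at hA
  rw [frobenius_norm_sq_fin_two]
  nlinarith [sq_nonneg (A 0 0 - A 1 1), sq_nonneg (A 0 1 + A 1 0)]

theorem one_le_norm_of_det_eq_one {A : Matrix (Fin 2) (Fin 2) ℝ} (hA : A.det = 1) :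
    1 ≤ ‖A‖ := by
  nlinarith [two_le_norm_sq_of_det_eq_one hA, norm_nonneg A]

theorem norm_adjugate_fin_two (A : Matrix (Fin 2) (Fin 2) ℝ) : ‖A.adjugate‖ = ‖A‖ := by
  have h : ‖A.adjugate‖ ^ 2 = ‖A‖ ^ 2 := by
    rw [frobenius_norm_sq_fin_two, frobenius_norm_sq_fin_two, Matrix.adjugate_fin_two]
    simp
    ring
  exact (sq_eq_sq₀ (norm_nonneg _) (norm_nonneg _)).1 h

/-- For a factor of rank one, the loss in `‖A * R * C‖` against `‖A‖ * ‖R‖ * ‖C‖` is the product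
of the losses at the two multiplication signs. -/
theorem norm_mul_vecMulVec_mul (A C : Matrix (Fin 2) (Fin 2) ℝ) (x y : Fin 2 → ℝ) :
    ‖A * Matrix.vecMulVec x y‖ * ‖Matrix.vecMulVec x y * C‖ =
      ‖Matrix.vecMulVec x y‖ * ‖A * Matrix.vecMulVec x y * C‖ := by
  refine (sq_eq_sq₀ (by positivity) (by positivity)).1 ?_
  simp only [mul_pow, frobenius_norm_sq_fin_two, Matrix.mul_apply, Fin.sum_univ_two,
    Matrix.vecMulVec_apply]
  ring

/-- A unimodular matrix is approximated by a matrix of rank one, with an error inversely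
proportional to its norm: project the shorter column onto the line of the longer one. -/
theorem exists_rankOne_approx {B : Matrix (Fin 2) (Fin 2) ℝ} (hB : B.det = 1) :
    ∃ x y : Fin 2 → ℝ, ‖Matrix.vecMulVec x y‖ ≤ ‖B‖ ∧
      ‖B - Matrix.vecMulVec x y‖ * ‖B‖ ≤ 2 := by
  rw [Matrix.det_fin_two] at hB
  have key : ∀ p r q s n : ℝ, n = p ^ 2 + r ^ 2 → q ^ 2 + s ^ 2 ≤ n → (p * s - q * r) ^ 2 = 1 →
      0 < n ∧ n + ((q * p + s * r) / n) ^ 2 * n ≤ n + (q ^ 2 + s ^ 2) ∧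
      ((q - p * ((q * p + s * r) / n)) ^ 2 + (s - r * ((q * p + s * r) / n)) ^ 2) *
        (n + (q ^ 2 + s ^ 2)) ≤ 4 := by
    intro p r q s n hn hle hd
    have hpos : 0 < n := by
      rcases eq_or_lt_of_le (show 0 ≤ n by rw [hn]; positivity) with h | h
      · have hp : p = 0 := by nlinarith [sq_nonneg p, sq_nonneg r]
        have hr : r = 0 := by nlinarith [sq_nonneg p, sq_nonneg r]
        simp [hp, hr] at hd
      · exact h
    have e1 : ((q * p + s * r) / n) ^ 2 * n = q ^ 2 + s ^ 2 - 1 / n := by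
      field_simp
      rw [hn]; nlinarith
    have e2 : (q - p * ((q * p + s * r) / n)) ^ 2 + (s - r * ((q * p + s * r) / n)) ^ 2
        = 1 / n := by
      have : (q - p * ((q * p + s * r) / n)) ^ 2 + (s - r * ((q * p + s * r) / n)) ^ 2 =
        q ^ 2 + s ^ 2 - 2 * ((q * p + s * r) / n * (q * p + s * r)) +
          ((q * p + s * r) / n) ^ 2 * (p ^ 2 + r ^ 2) := by ring
      rw [this, ← hn, e1]
      have : (q * p + s * r) / n * (q * p + s * r) = ((q * p + s * r) / n) ^ 2 * n := by
        field_simp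
      rw [this, e1]; ring
    refine ⟨hpos, ?_, ?_⟩
    · rw [e1]; have : 0 < 1 / n := by positivity
      linarith
    · rw [e2, one_div, inv_mul_le_iff₀ hpos]; linarith
  rcases le_total (B 0 1 ^ 2 + B 1 1 ^ 2) (B 0 0 ^ 2 + B 1 0 ^ 2) with h | h
  · obtain ⟨-, h1, h2⟩ := key (B 0 0) (B 1 0) (B 0 1) (B 1 1) _ rfl h (by rw [hB]; norm_num)
    set t := (B 0 1 * B 0 0 + B 1 1 * B 1 0) / (B 0 0 ^ 2 + B 1 0 ^ 2)
    refine ⟨![B 0 0, B 1 0], ![1, t], ?_, ?_⟩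
    · refine (sq_le_sq₀ (norm_nonneg _) (norm_nonneg _)).1 ?_
      simp only [frobenius_norm_sq_fin_two, Matrix.vecMulVec_apply]
      simp
      nlinarith
    · refine (sq_le_sq₀ (by positivity) (by norm_num)).1 ?_
      simp only [mul_pow, frobenius_norm_sq_fin_two, Matrix.sub_apply, Matrix.vecMulVec_apply]
      simp
      nlinarith
  · obtain ⟨-, h1, h2⟩ := key (B 0 1) (B 1 1) (B 0 0) (B 1 0) _ rfl h (by nlinarith)
    set t := (B 0 0 * B 0 1 + B 1 0 * B 1 1) / (B 0 1 ^ 2 + B 1 1 ^ 2)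
    refine ⟨![B 0 1, B 1 1], ![t, 1], ?_, ?_⟩
    · refine (sq_le_sq₀ (norm_nonneg _) (norm_nonneg _)).1 ?_
      simp only [frobenius_norm_sq_fin_two, Matrix.vecMulVec_apply]
      simp
      nlinarith
    · refine (sq_le_sq₀ (by positivity) (by norm_num)).1 ?_
      simp only [mul_pow, frobenius_norm_sq_fin_two, Matrix.sub_apply, Matrix.vecMulVec_apply]
      simp
      nlinarith

/-- The elementary estimate behind `norm_triple_mul_ge`. -/
theorem mul_le_of_mul_le_mul {X g b u v w : ℝ} (hX : 4 ≤ X) (hg : 2 * X ^ 2 ≤ g) (hb : 0 ≤ b)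
    (hu : g ^ 2 * X ^ 6 - 2 * X ^ 2 ≤ u) (hv : b - 2 / (g * X ^ 3) * (b / g) ≤ v)
    (hw : u * v ≤ g * X ^ 5 * w) : (g + 1) * b ≤ w := by
  have hXpos : 0 < X := by linarith
  have hg1 : 32 ≤ g := by nlinarith
  have hgpos : 0 < g := by linarith
  obtain ⟨q, hq⟩ : ∃ q, q = b / (g * X) := ⟨_, rfl⟩
  have hq0 : 0 ≤ q := by rw [hq]; positivity
  have hbq : b = q * (g * X) := by rw [hq]; field_simp
  have hgX : 1 ≤ g * X := by nlinarith
  have hsmall : 2 / (g * X ^ 3) * (b / g) ≤ q := by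
    have e : 2 / (g * X ^ 3) * (b / g) = q * (2 / (g * X ^ 2)) := by rw [hbq]; field_simp
    rw [e]
    have : 2 / (g * X ^ 2) ≤ 1 := by
      rw [div_le_one (by positivity)]
      nlinarith
    exact mul_le_of_le_one_right hq0 this
  have hA0 : 0 ≤ g ^ 2 * X ^ 6 - 2 * X ^ 2 := by
    have e : g ^ 2 * X ^ 6 - 2 * X ^ 2 = X ^ 2 * ((g * X ^ 2) ^ 2 - 2) := by ring
    have h1 : 2 ≤ g * X ^ 2 := by nlinarith
    rw [e]
    exact mul_nonneg (by positivity) (by nlinarith)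
  have hbq' : q ≤ b := by rw [hbq]; exact le_mul_of_one_le_right hq0 hgX
  have h1 : (g * X - 2) * b * (g * X ^ 5) ≤ (g ^ 2 * X ^ 6 - 2 * X ^ 2) * (b - q) := by
    rw [hbq, ← sub_nonneg]
    have e : (g ^ 2 * X ^ 6 - 2 * X ^ 2) * (q * (g * X) - q) -
        (g * X - 2) * (q * (g * X)) * (g * X ^ 5) =
        q * ((g * X ^ 3 - 1) ^ 2 + (2 * X ^ 2 - 1)) := by ring
    rw [e]
    have : 0 ≤ 2 * X ^ 2 - 1 := by nlinarith
    positivity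
  have h2 : (g ^ 2 * X ^ 6 - 2 * X ^ 2) * (b - q) ≤ u * v :=
    mul_le_mul hu (by linarith) (by linarith) (hA0.trans hu)
  have h3 := (h1.trans h2).trans hw
  rw [mul_comm (g * X ^ 5)] at h3
  have h4 := le_of_mul_le_mul_right h3 (by positivity)
  have e : (g * X - 2) * b - (g + 1) * b = b * (g * (X - 1) - 3) := by ring
  have : 0 ≤ b * (g * (X - 1) - 3) := mul_nonneg hb (by nlinarith)
  linarith

/-- The induction step of the avalanche principle: if `C` gains a factor `g` by multiplication with
the block `B`, then `B * C` gains a factor `g` by multiplication with the next block `A`. -/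
theorem norm_triple_mul_ge {A B C : Matrix (Fin 2) (Fin 2) ℝ} {X g : ℝ} (hX : 4 ≤ X)
    (hg : 2 * X ^ 2 ≤ g) (hB : B.det = 1) (hAle : ‖A‖ ≤ g * X ^ 5) (hBle : ‖B‖ ≤ g * X ^ 5)
    (hBge : g * X ^ 3 ≤ ‖B‖) (hAB : g ^ 2 * X ^ 6 ≤ ‖A * B‖) (hBC : g * ‖C‖ ≤ ‖B * C‖) :
    g * ‖B * C‖ ≤ ‖A * (B * C)‖ := by
  obtain ⟨x, y, hR, hS⟩ := exists_rankOne_approx hB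
  have hid := norm_mul_vecMulVec_mul A C x y
  obtain ⟨R, hRdef⟩ : ∃ R, R = Matrix.vecMulVec x y := ⟨_, rfl⟩
  rw [← hRdef] at hR hS hid
  obtain ⟨S, hSdef⟩ : ∃ S, S = B - R := ⟨_, rfl⟩
  rw [← hSdef] at hS
  have hBRS : B = R + S := by rw [hSdef]; abel
  have hXpos : 0 < X := by linarith
  have hgpos : 0 < g := by nlinarith
  have hC : ‖C‖ ≤ ‖B * C‖ / g := by rw [le_div_iff₀ hgpos]; linarith
  have hS' : ‖S‖ ≤ 2 / (g * X ^ 3) := by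
    rw [le_div_iff₀ (by positivity)]
    exact (mul_le_mul_of_nonneg_left hBge (norm_nonneg _)).trans hS
  have hAS : ‖A * S‖ ≤ 2 * X ^ 2 := by
    refine (norm_mul_le _ _).trans ((mul_le_mul hAle hS' (norm_nonneg _) (by positivity)).trans ?_)
    rw [show g * X ^ 5 * (2 / (g * X ^ 3)) = 2 * X ^ 2 by field_simp]
  have hAR : g ^ 2 * X ^ 6 - 2 * X ^ 2 ≤ ‖A * R‖ := by
    have := norm_add_le (A * R) (A * S)
    rw [← mul_add, ← hBRS] at this
    linarith
  have hSC : ‖S * C‖ ≤ 2 / (g * X ^ 3) * (‖B * C‖ / g) :=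
    (norm_mul_le _ _).trans (mul_le_mul hS' hC (norm_nonneg _) (by positivity))
  have hRC : ‖B * C‖ - 2 / (g * X ^ 3) * (‖B * C‖ / g) ≤ ‖R * C‖ := by
    have := norm_add_le (R * C) (S * C)
    rw [← add_mul, ← hBRS] at this
    linarith
  have hASC : ‖A * S * C‖ ≤ ‖B * C‖ := by
    refine (norm_mul_le _ _).trans
      ((mul_le_mul hAS hC (norm_nonneg _) (by positivity)).trans ?_)
    rw [mul_div_assoc', div_le_iff₀ hgpos, mul_comm]
    exact mul_le_mul_of_nonneg_left hg (norm_nonneg _)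
  have hABC : ‖A * R * C‖ - ‖A * S * C‖ ≤ ‖A * (B * C)‖ := by
    have := norm_sub_le (A * (B * C)) (A * S * C)
    have e : A * (B * C) - A * S * C = A * R * C := by
      rw [hBRS]
      noncomm_ring
    rw [e] at this
    linarith
  have := mul_le_of_mul_le_mul hX hg (norm_nonneg _) hAR hRC
    (hid.le.trans (mul_le_mul_of_nonneg_right (hR.trans hBle) (norm_nonneg _)))
  linarith

/-- The ordered product `A (n - 1) * ⋯ * A 1 * A 0`. -/
def orderedProd (A : ℕ → Matrix (Fin 2) (Fin 2) ℝ) : ℕ → Matrix (Fin 2) (Fin 2) ℝ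
  | 0 => 1
  | n + 1 => A n * orderedProd A n

theorem orderedProd_add (A : ℕ → Matrix (Fin 2) (Fin 2) ℝ) (m n : ℕ) :
    orderedProd A (m + n) = orderedProd (fun k => A (m + k)) n * orderedProd A m := by
  induction n with
  | zero => simp [orderedProd]
  | succ n ih => rw [← add_assoc, orderedProd, ih, orderedProd, mul_assoc]

theorem det_orderedProd {A : ℕ → Matrix (Fin 2) (Fin 2) ℝ} (hA : ∀ k, (A k).det = 1) (n : ℕ) :
    (orderedProd A n).det = 1 := by
  induction n with
  | zero => simp [orderedProd]
  | succ n ih => rw [orderedProd, Matrix.det_mul, hA, ih, one_mul]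

/-- A form of the avalanche principle: if no two neighbouring blocks cancel more than a small part
of their norms, the norm of the whole product grows exponentially in the number of blocks. -/
theorem pow_le_norm_orderedProd {A : ℕ → Matrix (Fin 2) (Fin 2) ℝ} {X g : ℝ} (hX : 4 ≤ X)
    (hg : 2 * X ^ 2 ≤ g) (hdet : ∀ k, (A k).det = 1) (hle : ∀ k, ‖A k‖ ≤ g * X ^ 5)
    (hge : ∀ k, g * X ^ 3 ≤ ‖A k‖) (hpair : ∀ k, g ^ 2 * X ^ 6 ≤ ‖A (k + 1) * A k‖) (n : ℕ) :
    g ^ n ≤ ‖orderedProd A n‖ := by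
  have hXpos : 0 < X := by linarith
  have hgpos : 0 < g := by nlinarith
  have h0 : g ≤ ‖A 0‖ := le_trans (by
    have : 1 ≤ X ^ 3 := one_le_pow₀ (by linarith)
    nlinarith) (hge 0)
  have step : ∀ n, g * ‖orderedProd A (n + 1)‖ ≤ ‖orderedProd A (n + 2)‖ := by
    intro n
    induction n with
    | zero =>
      have h2 := hpair 0
      have h1 := hle 0
      simp only [orderedProd, mul_one, zero_add] at h2 h1 ⊢
      have : g * (g * X ^ 5) ≤ g ^ 2 * X ^ 6 := by
        have : 0 ≤ g ^ 2 * X ^ 5 * (X - 1) := by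
          have : 0 ≤ X - 1 := by linarith
          positivity
        nlinarith
      nlinarith
    | succ n ih =>
      exact norm_triple_mul_ge hX hg (hdet _) (hle _) (hle _) (hge _) (hpair _) ih
  rcases n with _ | n
  · simp only [pow_zero, orderedProd]
    exact one_le_norm_of_det_eq_one (by simp)
  · induction n with
    | zero => simpa [orderedProd] using h0
    | succ n ih =>
      rw [pow_succ']
      exact (mul_le_mul_of_nonneg_left ih hgpos.le).trans (step n)

theorem opNorm_le_norm (M : Matrix (Fin 2) (Fin 2) ℝ) : opNorm M ≤ ‖M‖ := by
  refine ContinuousLinearMap.opNorm_le_bound _ (norm_nonneg _) fun v => ?_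
  refine (sq_le_sq₀ (norm_nonneg _) (by positivity)).1 ?_
  rw [mul_pow, frobenius_norm_sq_fin_two, EuclideanSpace.real_norm_sq_eq,
    EuclideanSpace.real_norm_sq_eq]
  simp only [Matrix.ofLp_toEuclideanCLM, Matrix.mulVec, dotProduct, Fin.sum_univ_two]
  nlinarith [sq_nonneg (M 0 0 * v 1 - M 0 1 * v 0), sq_nonneg (M 1 0 * v 1 - M 1 1 * v 0)]

theorem norm_sq_le_two_mul_opNorm_sq (M : Matrix (Fin 2) (Fin 2) ℝ) :
    ‖M‖ ^ 2 ≤ 2 * opNorm M ^ 2 := by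
  have hcol : ∀ j : Fin 2, M 0 j ^ 2 + M 1 j ^ 2 ≤ opNorm M ^ 2 := by
    intro j
    have h := (Matrix.toEuclideanCLM (n := Fin 2) (𝕜 := ℝ) M).le_opNorm
      (EuclideanSpace.single j (1 : ℝ))
    rw [PiLp.norm_single, norm_one, mul_one] at h
    have h2 := (sq_le_sq₀ (norm_nonneg _) (norm_nonneg _)).2 h
    rw [EuclideanSpace.real_norm_sq_eq] at h2
    unfold opNorm
    simpa [Matrix.ofLp_toEuclideanCLM, Fin.sum_univ_two] using h2
  rw [frobenius_norm_sq_fin_two]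
  linarith [hcol 0, hcol 1]

theorem norm_le_two_mul_opNorm (M : Matrix (Fin 2) (Fin 2) ℝ) : ‖M‖ ≤ 2 * opNorm M := by
  have hn : 0 ≤ opNorm M := norm_nonneg _
  refine (sq_le_sq₀ (norm_nonneg _) (by positivity)).1 ?_
  nlinarith [norm_sq_le_two_mul_opNorm_sq M]

theorem one_le_opNorm_of_det_eq_one {M : Matrix (Fin 2) (Fin 2) ℝ} (hM : M.det = 1) :
    1 ≤ opNorm M := by
  have hn : 0 ≤ opNorm M := norm_nonneg _
  nlinarith [norm_sq_le_two_mul_opNorm_sq M, two_le_norm_sq_of_det_eq_one hM]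

theorem opNorm_mul_le (A B : Matrix (Fin 2) (Fin 2) ℝ) :
    opNorm (A * B) ≤ opNorm A * opNorm B := by
  unfold opNorm
  rw [map_mul]
  exact norm_mul_le _ _

theorem opNorm_one : opNorm 1 = 1 := by
  unfold opNorm
  rw [map_one]
  exact norm_one

theorem continuous_opNorm : Continuous opNorm :=
  continuous_norm.comp (LinearMap.continuous_of_finiteDimensional
    (Matrix.toEuclideanCLM (n := Fin 2) (𝕜 := ℝ)).toAlgEquiv.toLinearMap)

/-! ### Subadditive processes over an ergodic map -/

section Ergodic

variable {α : Type*} [MeasurableSpace α] {μ : Measure α} {T : α → α}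

theorem integral_abs_le_norm_toLp [IsProbabilityMeasure μ] {g : α → ℝ} (hg : MemLp g 2 μ) :
    ∫ x, |g x| ∂μ ≤ ‖hg.toLp g‖ := by
  rw [Lp.norm_toLp]
  have h : ∫ x, |g x| ∂μ = (eLpNorm g 1 μ).toReal := by
    rw [eLpNorm_one_eq_lintegral_enorm, ← integral_norm_eq_lintegral_enorm hg.1]
    rfl
  rw [h]
  exact ENNReal.toReal_mono hg.eLpNorm_ne_top
    (eLpNorm_le_eLpNorm_of_exponent_le (by norm_num) hg.1)

theorem memLp_birkhoffSum (hT : MeasurePreserving T μ μ) {f : α → ℝ} (hf : MemLp f 2 μ) (n : ℕ) :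
    MemLp (birkhoffSum T f n) 2 μ := by
  have : birkhoffSum T f n = fun x => ∑ k ∈ Finset.range n, (f ∘ T^[k]) x := by
    ext x; simp [birkhoffSum]
  rw [this]
  exact memLp_finsetSum _ fun k _ => hf.comp_measurePreserving (hT.iterate k)

theorem memLp_birkhoffAverage (hT : MeasurePreserving T μ μ) {f : α → ℝ} (hf : MemLp f 2 μ)
    (n : ℕ) : MemLp (birkhoffAverage ℝ T f n) 2 μ :=
  (memLp_birkhoffSum hT hf n).const_smul ((n : ℝ)⁻¹)

/-- The averages of the Koopman operator on `L²` are the classes of the pointwise averages. -/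
theorem birkhoffAverage_compMeasurePreserving_toLp (hT : MeasurePreserving T μ μ) {f : α → ℝ}
    (hf : MemLp f 2 μ) (n : ℕ) :
    birkhoffAverage ℝ (Lp.compMeasurePreservingₗᵢ ℝ T hT : Lp ℝ 2 μ → Lp ℝ 2 μ) _root_.id n
      (hf.toLp f) = (memLp_birkhoffAverage hT hf n).toLp _ := by
  have hit : ∀ k, (Lp.compMeasurePreservingₗᵢ ℝ T hT : Lp ℝ 2 μ → Lp ℝ 2 μ)^[k] (hf.toLp f) =
      (hf.comp_measurePreserving (hT.iterate k)).toLp _ := by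
    intro k
    induction k with
    | zero => rfl
    | succ k ih =>
      rw [Function.iterate_succ_apply', ih]
      exact Lp.toLp_compMeasurePreserving (hf.comp_measurePreserving (hT.iterate k)) hT
  have hsum : birkhoffSum (Lp.compMeasurePreservingₗᵢ ℝ T hT : Lp ℝ 2 μ → Lp ℝ 2 μ)
      _root_.id n (hf.toLp f) = (memLp_birkhoffSum hT hf n).toLp _ := by
    induction n with
    | zero =>
      simp only [birkhoffSum_zero]
      exact (MemLp.toLp_zero _).symm
    | succ n ih =>
      rw [birkhoffSum_succ, ih, id, hit, ← MemLp.toLp_add]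
      congr 1
      ext x
      simp [birkhoffSum_succ]
  rw [birkhoffAverage, hsum]
  rfl

/-- The mean ergodic theorem in `L¹`, deduced from von Neumann's theorem for the Koopman operator
on `L²`, whose fixed points are constant by ergodicity. -/
theorem tendsto_integral_abs_birkhoffAverage_sub [IsProbabilityMeasure μ] (hT : Ergodic T μ)
    {f : α → ℝ} (hf : MemLp f 2 μ) :
    Tendsto (fun n => ∫ x, |birkhoffAverage ℝ T f n x - ∫ y, f y ∂μ| ∂μ) atTop (𝓝 0) := by
  have hp := hT.toMeasurePreserving
  set U : Lp ℝ 2 μ →L[ℝ] Lp ℝ 2 μ :=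
    (Lp.compMeasurePreservingₗᵢ ℝ T hp).toContinuousLinearMap with hU
  obtain ⟨z, hUz, hz⟩ : ∃ z : Lp ℝ 2 μ, U z = z ∧
      Tendsto (fun n => birkhoffAverage ℝ U _root_.id n (hf.toLp f)) atTop (𝓝 z) :=
    ⟨_, ((U.eqLocus (1 : Lp ℝ 2 μ →L[ℝ] Lp ℝ 2 μ)).orthogonalProjectionOnto (hf.toLp f)).2,
      U.tendsto_birkhoffAverage_orthogonalProjection
        (LinearIsometry.norm_toContinuousLinearMap_le _) (hf.toLp f)⟩
  obtain ⟨c, hc⟩ := hT.eq_const_of_compMeasurePreserving_eq (g := z.1)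
    (congrArg Subtype.val hUz)
  have hzc : z = (memLp_const c).toLp (fun _ : α => c) := by
    apply Lp.ext
    refine EventuallyEq.trans ?_ (MemLp.coeFn_toLp (memLp_const c)).symm
    change (z.1 : α → ℝ) =ᵐ[μ] _
    rw [hc]
    exact AEEqFun.coeFn_const α c
  have hz' : Tendsto (fun n => ∫ x, |birkhoffAverage ℝ T f n x - c| ∂μ) atTop (𝓝 0) := by
    have hn := (tendsto_iff_norm_sub_tendsto_zero.1 hz)
    refine squeeze_zero (fun n => integral_nonneg fun x => abs_nonneg _) (fun n => ?_) hn
    have h := integral_abs_le_norm_toLp ((memLp_birkhoffAverage hp hf n).sub (memLp_const c))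
    rw [MemLp.toLp_sub (memLp_birkhoffAverage hp hf n) (memLp_const c), ← hzc, ← birkhoffAverage_compMeasurePreserving_toLp hp hf n] at h
    exact h
  have hint : ∀ n, Integrable (birkhoffAverage ℝ T f n) μ := fun n =>
    (memLp_birkhoffAverage hp hf n).integrable (by norm_num)
  have hmean : ∀ n : ℕ, n ≠ 0 → ∫ x, birkhoffAverage ℝ T f n x ∂μ = ∫ y, f y ∂μ := by
    intro n hn
    simp only [birkhoffAverage, birkhoffSum, smul_eq_mul]
    rw [integral_const_mul, integral_finsetSum]
    · have : ∀ k ∈ Finset.range n, ∫ x, f (T^[k] x) ∂μ = ∫ y, f y ∂μ := fun k _ => by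
        have hk := hp.iterate k
        have := integral_map (μ := μ) (φ := T^[k]) hk.aemeasurable (f := f)
          (by rw [hk.map_eq]; exact hf.1)
        rw [hk.map_eq] at this
        exact this.symm
      rw [Finset.sum_congr rfl this]
      simp [hn]
    · exact fun k _ => ((hf.comp_measurePreserving (hp.iterate k)).integrable (by norm_num))
  have hcf : ∫ y, f y ∂μ = c := by
    have : ∀ᶠ n : ℕ in atTop, |∫ y, f y ∂μ - c| ≤ ∫ x, |birkhoffAverage ℝ T f n x - c| ∂μ := by
      filter_upwards [eventually_ne_atTop 0] with n hn
      have : ∫ y, f y ∂μ - c = ∫ x, (birkhoffAverage ℝ T f n x - c) ∂μ := by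
        rw [integral_sub (hint n) (integrable_const c), hmean n hn]
        simp
      rw [this]
      exact abs_integral_le_integral_abs
    have := ge_of_tendsto hz' this
    exact sub_eq_zero.1 (abs_eq_zero.1 (le_antisymm this (abs_nonneg _)))
  rw [hcf]
  exact hz'

theorem sum_range_mul_eq_sum_sum (f : ℕ → ℝ) (N q : ℕ) :
    ∑ j ∈ Finset.range (q * N), f j =
      ∑ r ∈ Finset.range N, ∑ i ∈ Finset.range q, f (r + i * N) := by
  induction q with
  | zero => simp
  | succ q ih =>
    rw [add_mul, one_mul, Finset.sum_range_add, ih, ← Finset.sum_add_distrib]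
    refine Finset.sum_congr rfl fun r _ => ?_
    rw [Finset.sum_range_succ, add_comm r]

/-- `F` is a nonnegative subadditive process over the map `T`, in the sense of Kingman, with the
linear bound `F n ≤ K * n`. -/
structure IsSubadditiveProcess (T : α → α) (F : ℕ → α → ℝ) (K : ℝ) : Prop where
  measurable : ∀ n, Measurable (F n)
  nonneg : ∀ n x, 0 ≤ F n x
  le_mul : ∀ n x, F n x ≤ K * n
  add_le : ∀ m n x, F (m + n) x ≤ F m x + F n (T^[m] x)

namespace IsSubadditiveProcess

variable {F : ℕ → α → ℝ} {K : ℝ}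

theorem nonneg_bound [Nonempty α] (h : IsSubadditiveProcess T F K) : 0 ≤ K := by
  inhabit α
  simpa using (h.nonneg 1 default).trans (h.le_mul 1 default)

theorem le_sum_blocks (h : IsSubadditiveProcess T F K) (N q : ℕ) (x : α) :
    F (q * N) x ≤ ∑ i ∈ Finset.range q, F N (T^[i * N] x) := by
  induction q with
  | zero => simpa using h.le_mul 0 x
  | succ q ih =>
    rw [add_mul, one_mul, Finset.sum_range_succ]
    exact (h.add_le _ _ _).trans (add_le_add_left ih _)

/-- A subadditive process is dominated by the Birkhoff sums of any of its members. -/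
theorem mul_le_birkhoffSum [Nonempty α] (h : IsSubadditiveProcess T F K) (N n : ℕ) (x : α) :
    N * F n x ≤ birkhoffSum T (F N) n x + 2 * K * N * N := by
  have hK := h.nonneg_bound
  rcases lt_or_ge n N with hn | hn
  · have h1 : F n x ≤ K * N := (h.le_mul n x).trans (by gcongr)
    have h2 : 0 ≤ birkhoffSum T (F N) n x := Finset.sum_nonneg fun _ _ => h.nonneg _ _
    have h3 : (N : ℝ) * F n x ≤ N * (K * N) := by gcongr
    have h4 : 0 ≤ K * N * N := by positivity
    linarith
  have hN : ∀ r ∈ Finset.range N, F n x ≤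
      ∑ i ∈ Finset.range (n / N - 1), F N (T^[r + i * N] x) + 2 * K * N := by
    intro r hr
    rw [Finset.mem_range] at hr
    have hq : 1 ≤ n / N := (Nat.one_le_div_iff (by omega)).2 hn
    obtain ⟨p, hp⟩ : ∃ p, n / N = p + 1 := ⟨n / N - 1, by omega⟩
    have hdm := Nat.div_add_mod n N
    have hmod := Nat.mod_lt n (show N > 0 by omega)
    rw [hp, mul_add, mul_comm N p] at hdm
    obtain ⟨s, hs⟩ : ∃ s, n = r + (p * N + s) := ⟨n - r - p * N, by omega⟩
    have hrs : r + s ≤ 2 * N := by omega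
    rw [hp, Nat.add_sub_cancel]
    have e1 := h.add_le r (p * N + s) x
    have e2 := h.add_le (p * N) s (T^[r] x)
    have e3 := h.le_sum_blocks N p (T^[r] x)
    have e4 := h.le_mul r x
    have e5 := h.le_mul s (T^[p * N] (T^[r] x))
    have e6 : K * r + K * s ≤ 2 * K * N := by
      have : (r : ℝ) + s ≤ 2 * N := by exact_mod_cast hrs
      nlinarith
    have e7 : ∑ i ∈ Finset.range p, F N (T^[i * N] (T^[r] x)) =
        ∑ i ∈ Finset.range p, F N (T^[r + i * N] x) :=
      Finset.sum_congr rfl fun i _ => by rw [add_comm r, Function.iterate_add_apply]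
    rw [← hs] at e1
    linarith
  have hsum := Finset.sum_le_sum hN
  rw [Finset.sum_const, Finset.card_range, nsmul_eq_mul, Finset.sum_add_distrib,
    ← sum_range_mul_eq_sum_sum (fun j => F N (T^[j] x)), Finset.sum_const, Finset.card_range,
    nsmul_eq_mul] at hsum
  have hle : ∑ j ∈ Finset.range ((n / N - 1) * N), F N (T^[j] x) ≤
      birkhoffSum T (F N) n x := by
    refine Finset.sum_le_sum_of_subset_of_nonneg ?_ fun _ _ _ => h.nonneg _ _
    refine Finset.range_mono ((Nat.mul_le_mul_right N (Nat.sub_le _ _)).trans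
      (Nat.div_mul_le_self n N))
  linarith

theorem memLp [IsFiniteMeasure μ] (h : IsSubadditiveProcess T F K) (n : ℕ) (p : ℝ≥0∞) :
    MemLp (F n) p μ :=
  MemLp.of_bound (h.measurable n).aestronglyMeasurable (K * n) <| ae_of_all _ fun x => by
    rw [Real.norm_of_nonneg (h.nonneg n x)]
    exact h.le_mul n x

/-- Convergence in `L¹` in Kingman's theorem. The positive part of `F n / n - Λ` is small by the mean
ergodic theorem, and the integral of `F n / n - Λ` is nonnegative, which bounds the negative part. -/
theorem exists_tendsto_integral_abs [IsProbabilityMeasure μ] (h : IsSubadditiveProcess T F K)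
    (hT : Ergodic T μ) :
    ∃ Λ : ℝ, 0 ≤ Λ ∧ Tendsto (fun n : ℕ => ∫ x, |F n x / n - Λ| ∂μ) atTop (𝓝 0) := by
  have : Nonempty α := μ.nonempty_of_neZero
  have hK := h.nonneg_bound
  have hp := hT.toMeasurePreserving
  have hint : ∀ n, Integrable (F n) μ := fun n => (h.memLp n 1).integrable le_rfl
  set a : ℕ → ℝ := fun n => ∫ x, F n x ∂μ with ha
  have ha0 : ∀ n, 0 ≤ a n := fun n => integral_nonneg (h.nonneg n)
  have hcomp : ∀ m n, ∫ x, F n (T^[m] x) ∂μ = a n := fun m n => by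
    have hk := hp.iterate m
    have := integral_map (μ := μ) (φ := T^[m]) hk.aemeasurable (f := F n)
      (h.measurable n).aestronglyMeasurable
    rw [hk.map_eq] at this
    exact this.symm
  have hsub : Subadditive a := by
    intro m n
    have hi : Integrable (fun x => F n (T^[m] x)) μ :=
      (hp.iterate m).integrable_comp_of_integrable (hint n)
    rw [← hcomp m n, ha, ← integral_add (hint m) hi]
    exact integral_mono (hint _) ((hint m).add hi) (h.add_le m n)
  have hbdd : BddBelow (Set.range fun n => a n / n) :=
    ⟨0, by rintro _ ⟨n, rfl⟩; have := ha0 n; positivity⟩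
  have hlim := hsub.tendsto_lim hbdd
  have hΛ : 0 ≤ hsub.lim :=
    ge_of_tendsto' hlim fun n => by have := ha0 n; positivity
  refine ⟨hsub.lim, hΛ, ?_⟩
  set Λ := hsub.lim
  rw [Metric.tendsto_atTop']
  intro ε hε
  -- The Birkhoff sums of `F N`, for `N` with nearly optimal mean, dominate the process.
  obtain ⟨N, hN0, hN⟩ : ∃ N : ℕ, N ≠ 0 ∧ a N / N < Λ + ε / 8 :=
    ((eventually_ne_atTop 0).and
      (hlim.eventually (gt_mem_nhds (show Λ < Λ + ε / 8 by linarith)))).exists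
  have hNpos : (0 : ℝ) < N := by positivity
  have hN1 : (1 : ℝ) ≤ N := by exact_mod_cast Nat.one_le_iff_ne_zero.2 hN0
  have hB := tendsto_integral_abs_birkhoffAverage_sub hT (h.memLp (μ := μ) N 2)
  have hC : Tendsto (fun n : ℕ => 2 * K * N / (n : ℝ)) atTop (𝓝 0) :=
    tendsto_const_div_atTop_nhds_zero_nat _
  obtain ⟨n₀, hn₀⟩ := eventually_atTop.1
    ((hB.eventually (gt_mem_nhds (show 0 < ε / 8 by linarith))).and
      (hC.eventually (gt_mem_nhds (show 0 < ε / 8 by linarith))))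
  refine ⟨n₀, fun n hn => ?_⟩
  obtain ⟨h1, h2⟩ := hn₀ n hn.le
  have hnpos : (0 : ℝ) < n := by exact_mod_cast (Nat.zero_le _).trans_lt hn
  set Y : α → ℝ := fun x => |birkhoffAverage ℝ T (F N) n x - a N| with hY
  have hYint : Integrable Y μ :=
    (((memLp_birkhoffAverage hp (h.memLp (μ := μ) N 2) n).integrable (by norm_num)).sub
      (integrable_const _)).abs
  have hup : ∀ x, F n x / n - Λ ≤ Y x + ε / 4 := by
    intro x
    have e1 := h.mul_le_birkhoffSum N n x
    have e2 : birkhoffAverage ℝ T (F N) n x - a N ≤ Y x := le_abs_self _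
    have e3 : birkhoffSum T (F N) n x = n * birkhoffAverage ℝ T (F N) n x := by
      simp only [birkhoffAverage, smul_eq_mul]
      field_simp
    have e4 : F n x / n ≤ birkhoffAverage ℝ T (F N) n x / N + 2 * K * N / n := by
      rw [div_add_div _ _ hNpos.ne' hnpos.ne', div_le_div_iff₀ hnpos (by positivity)]
      rw [e3] at e1
      nlinarith
    have e5 : birkhoffAverage ℝ T (F N) n x / N ≤ (Y x + a N) / N := by
      gcongr
      linarith
    have e6 : Y x / N ≤ Y x := div_le_self (abs_nonneg _) hN1
    rw [add_div] at e5
    linarith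
  have habs : ∀ x, |F n x / n - Λ| ≤ 2 * (Y x + ε / 4) - (F n x / n - Λ) := by
    intro x
    have e1 := hup x
    have e2 : 0 ≤ Y x := abs_nonneg _
    rcases abs_cases (F n x / n - Λ) with ⟨e, -⟩ | ⟨e, -⟩ <;> rw [e] <;> linarith
  have hFint : Integrable (fun x => F n x / n - Λ) μ :=
    ((hint n).div_const _).sub (integrable_const _)
  have hYc : Integrable (fun x => Y x + ε / 4) μ := hYint.add (integrable_const _)
  have hI := integral_mono hFint.abs ((hYc.const_mul 2).sub hFint) habs
  have hI2 : ∫ x, ((fun x => 2 * (Y x + ε / 4)) - fun x => F n x / n - Λ) x ∂μ =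
      2 * (∫ x, Y x ∂μ + ε / 4) - (a n / n - Λ) := by
    simp only [Pi.sub_apply]
    rw [integral_sub (hYc.const_mul 2) hFint, integral_const_mul,
      integral_add hYint (integrable_const _), integral_sub ((hint n).div_const _)
      (integrable_const _)]
    simp [ha, integral_div]
  have hge : Λ ≤ a n / n := hsub.lim_le_div hbdd (by rintro rfl; simp at hnpos)
  have hpos : 0 ≤ ∫ x, |F n x / n - Λ| ∂μ := integral_nonneg fun _ => abs_nonneg _
  rw [Real.dist_eq, sub_zero, abs_of_nonneg hpos]
  have := hI.trans_eq hI2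
  linarith

/-- Convergence in measure in Kingman's theorem. -/
theorem exists_tendsto_measureReal [IsProbabilityMeasure μ] (h : IsSubadditiveProcess T F K)
    (hT : Ergodic T μ) :
    ∃ Λ : ℝ, 0 ≤ Λ ∧ ∀ δ > 0,
      Tendsto (fun n : ℕ => μ.real {x | δ * n ≤ |F n x - Λ * n|}) atTop (𝓝 0) := by
  obtain ⟨Λ, hΛ, hlim⟩ := h.exists_tendsto_integral_abs hT
  refine ⟨Λ, hΛ, fun δ hδ => ?_⟩
  have hlim' : Tendsto (fun n : ℕ => δ⁻¹ * ∫ x, |F n x / n - Λ| ∂μ) atTop (𝓝 0) := by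
    simpa using hlim.const_mul δ⁻¹
  refine squeeze_zero' (Eventually.of_forall fun n => measureReal_nonneg) ?_ hlim'
  filter_upwards [eventually_ne_atTop 0] with n hn
  have hnpos : (0 : ℝ) < n := by positivity
  have hint : Integrable (fun x => |F n x / n - Λ|) μ :=
    ((((h.memLp n 1).integrable le_rfl).div_const _).sub (integrable_const _)).abs
  have hM := mul_meas_ge_le_integral_of_nonneg (ae_of_all μ fun x => abs_nonneg _) hint δ
  have hset : {x | δ * n ≤ |F n x - Λ * n|} = {x | δ ≤ |F n x / n - Λ|} := by
    ext x
    have e : F n x / n - Λ = (F n x - Λ * n) / n := by field_simp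
    simp only [Set.mem_ofPred_eq]
    rw [e, abs_div, abs_of_pos hnpos, le_div_iff₀ hnpos]
  rw [hset, inv_mul_eq_div, le_div_iff₀ hδ, mul_comm]
  exact hM

end IsSubadditiveProcess

end Ergodic

/-! ### Cocycles over a minimal subshift at a good scale -/

theorem iterate_shift_one {𝒜 : Type*} (m : ℕ) (ω : ℤ → 𝒜) :
    (shift (1 : ℤ))^[m] ω = shift (m : ℤ) ω := by
  induction m generalizing ω with
  | zero => ext; simp
  | succ m ih =>
    rw [Function.iterate_succ_apply, ih]
    ext k
    simp only [shift_apply]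
    congr 1
    push_cast
    ring

/-- The product `M (ω (n - 1)) * ⋯ * M (ω 0)` along the first `n` letters of `ω`. -/
def cocycle {𝒜 : Type*} (M : 𝒜 → Matrix (Fin 2) (Fin 2) ℝ) (n : ℕ) (ω : ℤ → 𝒜) :
    Matrix (Fin 2) (Fin 2) ℝ :=
  orderedProd (fun k => M (ω k)) n

/-- The logarithm of the operator norm of `cocycle M n ω`. The operator norm, unlike the Frobenius
norm, has `‖1‖ = 1`, which makes this vanish for `n = 0`. -/
noncomputable def logCocycle {𝒜 : Type*} (M : 𝒜 → Matrix (Fin 2) (Fin 2) ℝ) (n : ℕ)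
    (ω : ℤ → 𝒜) : ℝ :=
  Real.log (opNorm (cocycle M n ω))

section Cocycle

variable {𝒜 : Type*} {M : 𝒜 → Matrix (Fin 2) (Fin 2) ℝ}

theorem cocycle_add (m n : ℕ) (ω : ℤ → 𝒜) :
    cocycle M (m + n) ω = cocycle M n (shift (m : ℤ) ω) * cocycle M m ω := by
  rw [cocycle, orderedProd_add]
  simp [cocycle]

theorem cocycle_succ (n : ℕ) (ω : ℤ → 𝒜) :
    cocycle M (n + 1) ω = M (ω n) * cocycle M n ω := rfl

theorem cocycle_one (ω : ℤ → 𝒜) : cocycle M 1 ω = M (ω 0) := by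
  simp [cocycle, orderedProd]

theorem cocycle_mul (n q : ℕ) (ω : ℤ → 𝒜) :
    cocycle M (q * n) ω =
      orderedProd (fun k => cocycle M n (shift ((k * n : ℕ) : ℤ) ω)) q := by
  induction q with
  | zero => simp [cocycle, orderedProd]
  | succ q ih => rw [add_mul, one_mul, cocycle_add, ih]; rfl

theorem orderedProd_congr {A B : ℕ → Matrix (Fin 2) (Fin 2) ℝ} {n : ℕ}
    (h : ∀ k < n, A k = B k) : orderedProd A n = orderedProd B n := by
  induction n with
  | zero => rfl
  | succ n ih =>
    rw [orderedProd, orderedProd, h n (Nat.lt_succ_self n), ih fun k hk => h k (by omega)]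

theorem logCocycle_congr {n : ℕ} {ω η : ℤ → 𝒜} (h : ∀ k < n, ω (k : ℤ) = η k) :
    logCocycle M n ω = logCocycle M n η := by
  rw [logCocycle, logCocycle, cocycle, cocycle, orderedProd_congr fun k hk => by rw [h k hk]]

theorem det_cocycle (hM : ∀ a, (M a).det = 1) (n : ℕ) (ω : ℤ → 𝒜) : (cocycle M n ω).det = 1 :=
  det_orderedProd (fun _ => hM _) n

theorem opNorm_cocycle_pos (hM : ∀ a, (M a).det = 1) (n : ℕ) (ω : ℤ → 𝒜) :
    0 < opNorm (cocycle M n ω) :=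
  one_pos.trans_le (one_le_opNorm_of_det_eq_one (det_cocycle hM n ω))

theorem exp_logCocycle (hM : ∀ a, (M a).det = 1) (n : ℕ) (ω : ℤ → 𝒜) :
    Real.exp (logCocycle M n ω) = opNorm (cocycle M n ω) :=
  Real.exp_log (opNorm_cocycle_pos hM n ω)

theorem logCocycle_nonneg (hM : ∀ a, (M a).det = 1) (n : ℕ) (ω : ℤ → 𝒜) :
    0 ≤ logCocycle M n ω :=
  Real.log_nonneg (one_le_opNorm_of_det_eq_one (det_cocycle hM n ω))

theorem logCocycle_add_le (hM : ∀ a, (M a).det = 1) (m n : ℕ) (ω : ℤ → 𝒜) :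
    logCocycle M (m + n) ω ≤ logCocycle M m ω + logCocycle M n (shift (m : ℤ) ω) := by
  rw [logCocycle, logCocycle, logCocycle, add_comm (Real.log _),
    ← Real.log_mul (opNorm_cocycle_pos hM _ _).ne' (opNorm_cocycle_pos hM _ _).ne', cocycle_add]
  refine Real.log_le_log ?_ (opNorm_mul_le _ _)
  rw [← cocycle_add]
  exact opNorm_cocycle_pos hM _ _

/-- `exp K`, with `K ≥ 0`, bounds the norms of all matrices `M a`. The Frobenius norm is used because
it is the same for the inverses. -/
def IsLogBound (M : 𝒜 → Matrix (Fin 2) (Fin 2) ℝ) (K : ℝ) : Prop :=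
  0 ≤ K ∧ ∀ a, ‖M a‖ ≤ Real.exp K

theorem exists_isLogBound [Finite 𝒜] (M : 𝒜 → Matrix (Fin 2) (Fin 2) ℝ) :
    ∃ K, IsLogBound M K := by
  obtain ⟨b, hb⟩ := (Set.finite_range fun a => ‖M a‖).bddAbove
  refine ⟨Real.log (max b 1), Real.log_nonneg (le_max_right _ _), fun a => ?_⟩
  rw [Real.exp_log (lt_max_of_lt_right one_pos)]
  exact (hb ⟨a, rfl⟩).trans (le_max_left _ _)

variable {K : ℝ}

theorem IsLogBound.opNorm_le (hK : IsLogBound M K) (a : 𝒜) : opNorm (M a) ≤ Real.exp K :=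
  (opNorm_le_norm _).trans (hK.2 a)

theorem IsLogBound.opNorm_adjugate_le (hK : IsLogBound M K) (a : 𝒜) :
    opNorm (M a).adjugate ≤ Real.exp K :=
  (opNorm_le_norm _).trans ((norm_adjugate_fin_two _).trans_le (hK.2 a))

theorem logCocycle_le (hM : ∀ a, (M a).det = 1) (hK : IsLogBound M K) (n : ℕ) (ω : ℤ → 𝒜) :
    logCocycle M n ω ≤ K * n := by
  induction n with
  | zero => simp [logCocycle, cocycle, orderedProd, opNorm_one]
  | succ n ih =>
    have h := logCocycle_add_le hM n 1 ω
    have h1 : logCocycle M 1 (shift (n : ℤ) ω) ≤ K := by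
      rw [logCocycle, cocycle_one]
      refine (Real.log_le_iff_le_exp ?_).2 (hK.opNorm_le _)
      exact one_pos.trans_le (one_le_opNorm_of_det_eq_one (hM _))
    push_cast
    linarith

theorem log_opNorm_mul_le {A B : Matrix (Fin 2) (Fin 2) ℝ} (hA : opNorm A ≤ Real.exp K)
    (hB : B.det = 1) (hAB : (A * B).det = 1) :
    Real.log (opNorm (A * B)) ≤ K + Real.log (opNorm B) := by
  have hB1 := one_le_opNorm_of_det_eq_one hB
  have hAB1 := one_le_opNorm_of_det_eq_one hAB
  rw [Real.log_le_iff_le_exp (by linarith), Real.exp_add, Real.exp_log (by linarith)]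
  exact (opNorm_mul_le _ _).trans (mul_le_mul_of_nonneg_right hA (by linarith))

/-- Deleting `n` letters at the right end of a word increases the logarithm of the norm by at most
`K * n`, as an inverse in `SL(2, ℝ)` has the same norm. -/
theorem logCocycle_le_add (hM : ∀ a, (M a).det = 1) (hK : IsLogBound M K) (m n : ℕ)
    (ω : ℤ → 𝒜) : logCocycle M m ω ≤ logCocycle M (m + n) ω + K * n := by
  induction n with
  | zero => simp
  | succ n ih =>
    have e : cocycle M (m + n) ω =
        (M (ω ((m + n : ℕ) : ℤ))).adjugate * cocycle M (m + (n + 1)) ω := by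
      rw [← add_assoc, cocycle_succ, ← mul_assoc, Matrix.adjugate_mul, hM, one_smul, one_mul]
    have h : logCocycle M (m + n) ω ≤ K + logCocycle M (m + (n + 1)) ω := by
      rw [logCocycle, e]
      refine log_opNorm_mul_le (hK.opNorm_adjugate_le _) (det_cocycle hM _ _) ?_
      rw [← e]; exact det_cocycle hM _ _
    push_cast
    linarith

/-- Moving the window by one letter changes the logarithm of the norm by a bounded amount. -/
theorem abs_logCocycle_shift_sub_le (hM : ∀ a, (M a).det = 1) (hK : IsLogBound M K) (n : ℕ)
    (ω : ℤ → 𝒜) : |logCocycle M n (shift 1 ω) - logCocycle M n ω| ≤ 2 * K := by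
  have e1 : cocycle M (n + 1) ω = cocycle M n (shift 1 ω) * M (ω 0) := by
    rw [add_comm, cocycle_add, cocycle_one]; rfl
  have h1 := logCocycle_le_add hM hK n 1 ω
  have h2 := logCocycle_add_le hM n 1 ω
  have h3 := logCocycle_le hM hK 1 (shift (n : ℤ) ω)
  have h4 := logCocycle_add_le hM 1 n ω
  have h5 := logCocycle_le hM hK 1 ω
  have h6 : logCocycle M n (shift 1 ω) ≤ logCocycle M (n + 1) ω + K := by
    have e : cocycle M n (shift 1 ω) = cocycle M (n + 1) ω * (M (ω 0)).adjugate := by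
      rw [e1, mul_assoc, Matrix.mul_adjugate, hM, one_smul, mul_one]
    have hd := det_cocycle hM (n + 1) ω
    have hp1 := opNorm_cocycle_pos hM (n + 1) ω
    rw [logCocycle, Real.log_le_iff_le_exp (opNorm_cocycle_pos hM _ _), Real.exp_add,
      exp_logCocycle hM, e]
    exact (opNorm_mul_le _ _).trans
      (mul_le_mul_of_nonneg_left (hK.opNorm_adjugate_le _) hp1.le)
  rw [add_comm 1 n] at h4
  push_cast at *
  rw [abs_le]
  constructor <;> linarith

end Cocycle

section Symbolic

variable {𝒜 : Type*} [TopologicalSpace 𝒜] [DiscreteTopology 𝒜]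

theorem continuous_logCocycle {M : 𝒜 → Matrix (Fin 2) (Fin 2) ℝ} (hM : ∀ a, (M a).det = 1)
    (n : ℕ) : Continuous (logCocycle M n) := by
  have hc : Continuous (cocycle M n) := by
    induction n with
    | zero => exact continuous_const
    | succ n ih =>
      exact (continuous_of_discreteTopology.comp (continuous_apply (n : ℤ))).mul ih
  exact (continuous_opNorm.comp hc).log fun ω => (opNorm_cocycle_pos hM n ω).ne'

/-- The discrete intermediate value theorem for a sequence with steps of size at most `L`. The
positions `p` and `q` may come in either order. -/
theorem exists_mem_Ico_of_abs_sub_le {g : ℤ → ℝ} {L t : ℝ} (hg : ∀ k, |g (k + 1) - g k| ≤ L)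
    {p q : ℤ} (hp : g p < t) (hq : t ≤ g q) : ∃ k, t ≤ g k ∧ g k < t + L := by
  have key : ∀ f : ℤ → ℝ, (∀ k, |f (k + 1) - f k| ≤ L) → ∀ (a : ℤ) (n : ℕ), f a < t →
      t ≤ f (a + n) → ∃ k, t ≤ f k ∧ f k < t + L := by
    intro f hf a n ha hn
    induction n with
    | zero => simp at hn; linarith
    | succ n ih =>
      by_cases h : t ≤ f (a + n)
      · exact ih h
      · refine ⟨_, hn, ?_⟩
        have h1 := (abs_le.1 (hf (a + n))).2
        push_cast
        rw [← add_assoc]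
        linarith [not_le.1 h]
  rcases le_total p q with h | h
  · obtain ⟨n, rfl⟩ := Int.exists_add_of_le h
    exact key g hg p n hp hq
  · obtain ⟨n, rfl⟩ := Int.exists_add_of_le h
    obtain ⟨k, hk⟩ := key (fun k => g (-k)) (fun k => by
      have := hg (-(k + 1))
      rw [abs_sub_comm] at this
      convert this using 4
      ring) (-(q + n)) n (by simpa using hp) (by simpa using hq)
    exact ⟨-k, hk⟩

variable {Ω : Subshift 𝒜 ℤ}

/-- In a minimal subshift every point contains every word. -/
theorem IsMinimal.exists_shift_eq (hΩ : IsMinimal Ω) {ω η : ℤ → 𝒜} (hω : ω ∈ Ω.carrier)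
    (hη : η ∈ Ω.carrier) (n : ℕ) : ∃ j : ℤ, ∀ k < n, shift j ω (k : ℤ) = η k := by
  have hcl := hΩ.2 ω hω hη
  have hopen : IsOpen {ξ : ℤ → 𝒜 | ∀ k < n, ξ (k : ℤ) = η k} := by
    have : {ξ : ℤ → 𝒜 | ∀ k < n, ξ (k : ℤ) = η k} =
        ⋂ k ∈ Set.Iio n, (fun ξ : ℤ → 𝒜 => ξ (k : ℤ)) ⁻¹' {η k} := by
      ext; simp
    rw [this]
    exact (Set.finite_Iio n).isOpen_biInter fun k _ =>
      (isOpen_discrete _).preimage (continuous_apply _)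
  obtain ⟨_, hx, j, rfl⟩ := mem_closure_iff.1 hcl _ hopen fun k _ => rfl
  exact ⟨j, hx⟩

variable [Finite 𝒜] [MeasurableSpace 𝒜] [BorelSpace 𝒜]

theorem isSubadditiveProcess_logCocycle {M : 𝒜 → Matrix (Fin 2) (Fin 2) ℝ} {K : ℝ}
    (hM : ∀ a, (M a).det = 1) (hK : IsLogBound M K) :
    IsSubadditiveProcess (shift (1 : ℤ)) (logCocycle M) K where
  measurable n := (continuous_logCocycle hM n).measurable
  nonneg := logCocycle_nonneg hM
  le_mul := logCocycle_le hM hK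
  add_le m n ω := by
    rw [iterate_shift_one]
    exact logCocycle_add_le hM m n ω

theorem measurableSet_wordCylinder {n : ℕ} (w : Fin n → 𝒜) :
    MeasurableSet (wordCylinder w) := by
  have : wordCylinder w = ⋂ i : Fin n, (fun ω : ℤ → 𝒜 => ω (i : ℤ)) ⁻¹' {w i} := by
    ext ω; simp [wordCylinder]
  rw [this]
  exact MeasurableSet.iInter fun i => measurable_pi_apply _ (MeasurableSet.singleton _)

/-- The word of length `n` that `ω` shows at the origin. -/
def window {𝒜 : Type*} (n : ℕ) (ω : ℤ → 𝒜) : Fin n → 𝒜 := fun i => ω i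

theorem mem_wordCylinder_window {𝒜 : Type*} {n : ℕ} {ω η : ℤ → 𝒜} :
    η ∈ wordCylinder (window n ω) ↔ ∀ k < n, η (k : ℤ) = ω k :=
  ⟨fun h k hk => h ⟨k, hk⟩, fun h i => h i i.2⟩

/-- All words of length `n` of `Ω` have `ν`-measure at least `c / n`. Every word of `Ω` is shown at
the origin by some point of `Ω`, so it is enough to consider the windows there. -/
def IsGoodScale (Ω : Subshift 𝒜 ℤ) (ν : Measure (ℤ → 𝒜)) (c : ℝ) (n : ℕ) : Prop :=
  ∀ ω ∈ Ω.carrier, c ≤ n * ν.real (wordCylinder (window n ω))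

/-- At large good scales, the norms of *all* words grow at the rate `Λ` that is typical for `ν`. -/
theorem abs_logCocycle_sub_le_of_isGoodScale (hΩ : IsMinimal Ω) {ν : Measure (ℤ → 𝒜)}
    (hν : IsErgodicMeasure Ω ν) {M : 𝒜 → Matrix (Fin 2) (Fin 2) ℝ} (hM : ∀ a, (M a).det = 1) :
    ∃ Λ : ℝ, 0 ≤ Λ ∧ ∀ c > 0, ∀ δ > 0, ∀ᶠ n : ℕ in atTop, IsGoodScale Ω ν c n →
      ∀ ω ∈ Ω.carrier, |logCocycle M n ω - Λ * n| ≤ δ * n := by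
  have := hν.isProbabilityMeasure
  obtain ⟨K, hK⟩ := exists_isLogBound M
  obtain ⟨Λ, hΛ, hlim⟩ :=
    (isSubadditiveProcess_logCocycle hM hK).exists_tendsto_measureReal hν.ergodic
  refine ⟨Λ, hΛ, fun c hc δ hδ => ?_⟩
  obtain ⟨L, hL, hKL⟩ : ∃ L : ℝ, 0 < L ∧ 2 * K ≤ L := ⟨2 * K + 1, by linarith [hK.1], by linarith⟩
  have hsmall : ∀ᶠ n : ℕ in atTop,
      ν.real {ω | δ / 2 * n ≤ |logCocycle M n ω - Λ * n|} < min 1 (c * δ / (4 * L)) :=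
    (hlim (δ / 2) (by linarith)).eventually (gt_mem_nhds (by positivity))
  filter_upwards [hsmall, eventually_ge_atTop (⌈4 * L / δ⌉₊ + 1)] with n hn hnL hgood ω hω
  rw [lt_min_iff] at hn
  have hnpos : (0 : ℝ) < n := by exact_mod_cast (by omega : 0 < n)
  have hnδ : 4 * L ≤ δ * n := by
    have : 4 * L / δ ≤ n := (Nat.le_ceil _).trans (by exact_mod_cast (by omega))
    rwa [div_le_iff₀' hδ] at this
  by_contra! hbig
  -- The typical set has measure close to one, so some window of `Ω` is typical.
  obtain ⟨η, hη, hηsmall⟩ : ∃ η ∈ Ω.carrier, |logCocycle M n η - Λ * n| < δ / 2 * n := by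
    by_contra! hcon
    have h1 : (1 : ℝ) ≤ ν.real {ω | δ / 2 * n ≤ |logCocycle M n ω - Λ * n|} := by
      have hone : ν.real Ω.carrier = 1 := by
        have := (prob_compl_eq_zero_iff Ω.isClosed.measurableSet (μ := ν)).1 hν.carrier_compl
        simp [Measure.real, this]
      rw [← hone]
      exact measureReal_mono hcon
    linarith [hn.1]
  obtain ⟨j, hj⟩ := hΩ.exists_shift_eq hω hη n
  set g : ℤ → ℝ := fun k => |logCocycle M n (shift k ω) - Λ * n| with hg
  have hgL : ∀ k, |g (k + 1) - g k| ≤ L := by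
    intro k
    have h1 := abs_logCocycle_shift_sub_le hM hK n (shift k ω)
    rw [← shift_add] at h1
    refine (abs_abs_sub_abs_le_abs_sub _ _).trans ?_
    rw [sub_sub_sub_cancel_right]
    linarith
  have hgj : g j < δ / 2 * n := by
    simp only [hg]
    rwa [logCocycle_congr hj]
  have hg0 : δ * n < g 0 := by simpa [hg] using hbig
  set m : ℕ := ⌊δ * n / (2 * L)⌋₊ with hm
  have hmle : (m : ℝ) * L ≤ δ / 2 * n := by
    have := Nat.floor_le (show 0 ≤ δ * n / (2 * L) by positivity)
    rw [← hm, le_div_iff₀ (by positivity)] at this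
    linarith
  have hmge : δ * n / (4 * L) ≤ m := by
    have h1 := Nat.lt_floor_add_one (δ * n / (2 * L))
    rw [← hm] at h1
    have h2 : 1 ≤ δ * n / (4 * L) := by rw [le_div_iff₀ (by positivity)]; linarith
    have h3 : δ * n / (2 * L) = 2 * (δ * n / (4 * L)) := by field_simp; norm_num
    linarith
  -- On the way from `ω` to the typical window the deviation meets `m` disjoint intervals of length
  -- `L` between `δ / 2 * n` and `δ * n`.
  have hex : ∀ i : ℕ, ∃ k : ℤ, i < m →
      δ / 2 * n + i * L ≤ g k ∧ g k < δ / 2 * n + i * L + L := by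
    intro i
    by_cases hi : i < m
    · have hi' : (i : ℝ) * L ≤ m * L := by gcongr
      obtain ⟨k, hk⟩ := exists_mem_Ico_of_abs_sub_le hgL
        (t := δ / 2 * n + i * L) (p := j) (q := 0)
        (by have : 0 ≤ (i : ℝ) * L := by positivity
            linarith) (by linarith)
      exact ⟨k, fun _ => hk⟩
    · exact ⟨0, fun h => absurd h hi⟩
  choose k hk using hex
  have hcyl : ∀ i, ∀ ξ ∈ wordCylinder (window n (shift (k i) ω)),
      |logCocycle M n ξ - Λ * n| = g (k i) := by
    intro i ξ hξ
    rw [logCocycle_congr (mem_wordCylinder_window.1 hξ)]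
  -- The deviation is constant on the cylinders, so the cylinders met on the way are disjoint.
  have hdisj : (↑(Finset.range m) : Set ℕ).PairwiseDisjoint
      fun i => wordCylinder (window n (shift (k i) ω)) := by
    intro i hi i' hi' hne
    rw [Function.onFun, Set.disjoint_left]
    intro ξ h1 h2
    have e := (hcyl i ξ h1).symm.trans (hcyl i' ξ h2)
    have b1 := hk i (by simpa using hi)
    have b2 := hk i' (by simpa using hi')
    rw [← e] at b2
    rcases lt_or_gt_of_ne hne with h | h
    · have : ((i : ℝ) + 1) * L ≤ i' * L := by
        gcongr
        exact_mod_cast h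
      linarith
    · have : ((i' : ℝ) + 1) * L ≤ i * L := by
        gcongr
        exact_mod_cast h
      linarith
  have hsub : (⋃ i ∈ Finset.range m, wordCylinder (window n (shift (k i) ω))) ⊆
      {ω | δ / 2 * n ≤ |logCocycle M n ω - Λ * n|} := by
    intro ξ hξ
    simp only [Set.mem_iUnion, Finset.mem_range] at hξ
    obtain ⟨i, hi, hξ⟩ := hξ
    rw [Set.mem_ofPred_eq, hcyl i ξ hξ]
    have : 0 ≤ (i : ℝ) * L := by positivity
    linarith [(hk i hi).1]
  have hmeas := measureReal_mono (μ := ν) hsub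
  rw [measureReal_biUnion_finset hdisj fun i _ => measurableSet_wordCylinder _] at hmeas
  have hge : ∀ i ∈ Finset.range m, c / n ≤ ν.real (wordCylinder (window n (shift (k i) ω))) := by
    intro i _
    rw [div_le_iff₀' hnpos]
    exact hgood _ (Ω.mapsTo _ hω)
  have hsum := Finset.card_nsmul_le_sum _ _ _ hge
  rw [Finset.card_range, nsmul_eq_mul] at hsum
  have hfin : c * δ / (4 * L) ≤ m * (c / n) := by
    calc c * δ / (4 * L) = δ * n / (4 * L) * (c / n) := by field_simp
      _ ≤ m * (c / n) := by gcongr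
  linarith [hn.2]

end Symbolic

/-! ### Uniform convergence under the Boshernitzan condition -/

section Uniform

variable {𝒜 : Type*} [TopologicalSpace 𝒜] {Ω : Subshift 𝒜 ℤ}
  {M : 𝒜 → Matrix (Fin 2) (Fin 2) ℝ} {K : ℝ}

/-- Shorter words have larger cylinders, so a good scale yields good scales of comparable
length. -/
theorem IsGoodScale.of_le [MeasurableSpace 𝒜] {ν : Measure (ℤ → 𝒜)} [IsProbabilityMeasure ν]
    {c : ℝ} {l n : ℕ} (h : IsGoodScale Ω ν c n)
    (hln : l ≤ n) (hnl : n ≤ 3 * l) : IsGoodScale Ω ν (c / 3) l := by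
  intro ω hω
  have h1 := h ω hω
  have h2 : ν.real (wordCylinder (window n ω)) ≤ ν.real (wordCylinder (window l ω)) := by
    refine measureReal_mono fun η hη => ?_
    rw [mem_wordCylinder_window] at hη ⊢
    exact fun k hk => hη k (hk.trans_le hln)
  have h3 : (n : ℝ) ≤ 3 * l := by exact_mod_cast hnl
  have h4 : (n : ℝ) * ν.real (wordCylinder (window n ω)) ≤
      3 * l * ν.real (wordCylinder (window l ω)) := by gcongr
  linarith

/-- Condition (B) at length `n` gives good scales `n / 2` and `2 * (n / 2)`; the avalanche principle
needs both of them at the same time. -/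
theorem ConditionB.exists_frequently_isGoodScale [MeasurableSpace 𝒜] (hB : ConditionB Ω) :
    ∃ ν : Measure (ℤ → 𝒜), IsErgodicMeasure Ω ν ∧
      ∃ c > 0, ∃ᶠ l : ℕ in atTop, IsGoodScale Ω ν c l ∧ IsGoodScale Ω ν c (2 * l) := by
  obtain ⟨ν, hν, hlim⟩ := hB
  have := hν.isProbabilityMeasure
  refine ⟨ν, hν, ?_⟩
  obtain ⟨b, hb0, hb⟩ := exists_between hlim
  have hfreq := frequently_lt_of_lt_limsup (by isBoundedDefault) hb
  have hbtop : b ≠ ∞ := (hb.trans_le le_top).ne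
  have hbpos : 0 < b.toReal := ENNReal.toReal_pos hb0.ne' hbtop
  refine ⟨b.toReal / 3, by positivity, ?_⟩
  rw [frequently_atTop] at hfreq ⊢
  intro N
  obtain ⟨n, hn, hbn⟩ := hfreq (2 * N + 2)
  have hgood : IsGoodScale Ω ν b.toReal n := by
    intro ω hω
    have h1 : b ≤ n * ν (wordCylinder (window n ω)) :=
      hbn.le.trans (iInf₂_le _ ⟨ω, hω, 0, fun i => by simp [window]⟩)
    have h2 := ENNReal.toReal_mono
      (ENNReal.mul_ne_top (ENNReal.natCast_ne_top n) (measure_ne_top _ _)) h1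
    rwa [ENNReal.toReal_mul, ENNReal.toReal_natCast] at h2
  exact ⟨n / 2, by omega, hgood.of_le (by omega) (by omega), hgood.of_le (by omega) (by omega)⟩

theorem logCocycle_mul_le {B : ℝ} (hM : ∀ a, (M a).det = 1) {l : ℕ}
    (h : ∀ ω ∈ Ω.carrier, logCocycle M l ω ≤ B) (q : ℕ) {ω : ℤ → 𝒜} (hω : ω ∈ Ω.carrier) :
    logCocycle M (q * l) ω ≤ q * B := by
  induction q with
  | zero => simp [logCocycle, cocycle, orderedProd, opNorm_one]
  | succ q ih =>
    have h1 := logCocycle_add_le hM (q * l) l ω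
    have h2 := h _ (Ω.mapsTo ((q * l : ℕ) : ℤ) hω)
    rw [add_mul, one_mul]
    push_cast at *
    linarith

/-- Lower bound at all multiples of a length `l` if the growth rate is close to `Λ` for all words of
the lengths `l` and `2 * l`. The avalanche principle is used with `X = exp (δ * l)` and
`g = exp ((Λ - 4 * δ) * l)`; the hypothesis `hl` absorbs the factor `2` between the norms. -/
theorem mul_le_logCocycle_mul {Λ δ : ℝ} (hM : ∀ a, (M a).det = 1) (hδΛ : 8 * δ ≤ Λ) {l : ℕ}
    (hl : 2 * Real.log 2 ≤ δ * l)
    (h1 : ∀ ω ∈ Ω.carrier, |logCocycle M l ω - Λ * l| ≤ δ / 2 * l)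
    (h2 : ∀ ω ∈ Ω.carrier, |logCocycle M (2 * l) ω - Λ * (2 * l)| ≤ δ / 2 * (2 * l))
    (q : ℕ) {ω : ℤ → 𝒜} (hω : ω ∈ Ω.carrier) :
    (Λ - 4 * δ) * (q * l) - Real.log 2 ≤ logCocycle M (q * l) ω := by
  have hlog2 : 0 < Real.log 2 := Real.log_pos (by norm_num)
  have hδl : 0 < δ * l := by linarith
  have hΛl : 8 * (δ * l) ≤ Λ * l := by nlinarith [Nat.cast_nonneg (α := ℝ) l]
  set X := Real.exp (δ * l) with hX
  set g := Real.exp ((Λ - 4 * δ) * l) with hg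
  have hXn : ∀ n : ℕ, X ^ n = Real.exp (n * (δ * l)) := fun n => (Real.exp_nat_mul _ _).symm
  have hgn : ∀ n : ℕ, g ^ n = Real.exp (n * ((Λ - 4 * δ) * l)) :=
    fun n => (Real.exp_nat_mul _ _).symm
  have h4 : (4 : ℝ) ≤ X := by
    rw [hX, ← Real.log_le_iff_le_exp (by norm_num), show (4 : ℝ) = 2 ^ 2 by norm_num, Real.log_pow]
    push_cast
    linarith
  have hgX : 2 * X ^ 2 ≤ g := by
    rw [hXn, hg, ← Real.exp_log (show (0 : ℝ) < 2 by norm_num), ← Real.exp_add, Real.exp_le_exp]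
    push_cast
    linarith
  have hshift : ∀ k : ℕ, shift ((k * l : ℕ) : ℤ) ω ∈ Ω.carrier := fun k => Ω.mapsTo _ hω
  have hgrow := pow_le_norm_orderedProd (A := fun k => cocycle M l (shift ((k * l : ℕ) : ℤ) ω))
    h4 hgX (fun k => det_cocycle hM _ _) (fun k => ?_) (fun k => ?_) (fun k => ?_) q
  · rw [← cocycle_mul, hgn] at hgrow
    have h := hgrow.trans (norm_le_two_mul_opNorm _)
    rw [← exp_logCocycle hM, ← Real.exp_log (show (0 : ℝ) < 2 by norm_num), ← Real.exp_add,
      Real.exp_le_exp] at h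
    linarith
  · have h := (abs_le.1 (h1 _ (hshift k))).2
    refine (norm_le_two_mul_opNorm _).trans ?_
    rw [hXn, ← Real.exp_add, ← exp_logCocycle hM, ← Real.exp_log (show (0 : ℝ) < 2 by norm_num),
      ← Real.exp_add, Real.exp_le_exp]
    simp only [Nat.cast_ofNat]
    linarith
  · have h := (abs_le.1 (h1 _ (hshift k))).1
    refine le_trans ?_ (opNorm_le_norm _)
    rw [hXn, ← Real.exp_add, ← exp_logCocycle hM, Real.exp_le_exp]
    simp only [Nat.cast_ofNat]
    linarith
  · have h := (abs_le.1 (h2 _ (hshift k))).1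
    have e : cocycle M l (shift (((k + 1) * l : ℕ) : ℤ) ω) *
        cocycle M l (shift ((k * l : ℕ) : ℤ) ω) =
        cocycle M (2 * l) (shift ((k * l : ℕ) : ℤ) ω) := by
      rw [two_mul, cocycle_add, ← shift_add]
      congr 3
      push_cast
      ring
    rw [e]
    refine le_trans ?_ (opNorm_le_norm _)
    rw [hXn, hgn, ← Real.exp_add, ← exp_logCocycle hM, Real.exp_le_exp]
    simp only [Nat.cast_ofNat]
    linarith

/-- Under condition (B) every locally constant `SL(2, ℝ)` cocycle over a minimal subshift has a
uniform growth rate. -/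
theorem exists_uniform_logCocycle [MeasurableSpace 𝒜] [Finite 𝒜] [DiscreteTopology 𝒜] [BorelSpace 𝒜]
    (hΩ : IsMinimal Ω) (hB : ConditionB Ω) (hM : ∀ a, (M a).det = 1) :
    ∃ Λ : ℝ, 0 ≤ Λ ∧ ∀ ε > 0, ∃ C : ℝ, ∀ n : ℕ, ∀ ω ∈ Ω.carrier,
      |logCocycle M n ω - Λ * n| ≤ ε * n + C := by
  obtain ⟨ν, hν, c, hc, hfreq⟩ := hB.exists_frequently_isGoodScale
  obtain ⟨K, hK⟩ := exists_isLogBound M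
  obtain ⟨Λ, hΛ, hconc⟩ := abs_logCocycle_sub_le_of_isGoodScale hΩ hν hM
  refine ⟨Λ, hΛ, fun ε hε => ?_⟩
  have htwo : Tendsto (fun l : ℕ => 2 * l) atTop atTop :=
    tendsto_atTop_mono (fun l => by simp only [id]; omega) tendsto_id
  have hscale : ∀ δ > 0, ∃ l : ℕ, 0 < l ∧ 2 * Real.log 2 ≤ δ * l ∧
      (∀ ω ∈ Ω.carrier, |logCocycle M l ω - Λ * l| ≤ δ / 2 * l) ∧
      ∀ ω ∈ Ω.carrier, |logCocycle M (2 * l) ω - Λ * (2 * l)| ≤ δ / 2 * (2 * l) := by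
    intro δ hδ
    have hev := hconc c hc (δ / 2) (by linarith)
    have hlarge : ∀ᶠ l : ℕ in atTop, 2 * Real.log 2 ≤ δ * l :=
      (tendsto_natCast_atTop_atTop.const_mul_atTop hδ).eventually_ge_atTop _
    obtain ⟨l, ⟨g1, g2⟩, hl0, hl, e1, e2⟩ := (hfreq.and_eventually
      ((eventually_gt_atTop 0).and (hlarge.and (hev.and (htwo.eventually hev))))).exists
    refine ⟨l, hl0, hl, e1 g1, ?_⟩
    have := e2 g2
    push_cast at this
    exact this
  have hK0 := hK.1
  -- The upper bound follows from a single scale by subadditivity.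
  obtain ⟨C₁, hC₁, hup⟩ : ∃ C : ℝ, 0 ≤ C ∧ ∀ n : ℕ, ∀ ω ∈ Ω.carrier,
      logCocycle M n ω ≤ (Λ + ε) * n + C := by
    obtain ⟨l, hl0, -, h1, -⟩ := hscale ε hε
    refine ⟨K * l, by positivity, fun n ω hω => ?_⟩
    have hdm := Nat.div_add_mod n l
    have hmod := (Nat.mod_lt n hl0).le
    set q := n / l
    set r := n % l
    have e1 := logCocycle_add_le hM (q * l) r ω
    have e2 := logCocycle_mul_le hM (B := (Λ + ε) * l) (fun ω hω => by
      have := (abs_le.1 (h1 ω hω)).2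
      have : 0 ≤ ε * l := by positivity
      linarith) q hω
    have e3 := logCocycle_le hM hK r (shift ((q * l : ℕ) : ℤ) ω)
    have e4 : K * r ≤ K * l := by gcongr
    have hn : (n : ℝ) = l * q + r := by exact_mod_cast hdm.symm
    rw [mul_comm q l, hdm, mul_comm l q] at e1
    have e5 : 0 ≤ (Λ + ε) * r := by positivity
    rw [hn]
    linarith
  -- The lower bound is trivial for `Λ = 0`; otherwise it comes from the avalanche principle.
  obtain ⟨C₂, hC₂, hlow⟩ : ∃ C : ℝ, 0 ≤ C ∧ ∀ n : ℕ, ∀ ω ∈ Ω.carrier,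
      (Λ - ε) * n - C ≤ logCocycle M n ω := by
    rcases hΛ.eq_or_lt with h0 | hpos
    · refine ⟨0, le_rfl, fun n ω _ => le_trans ?_ (logCocycle_nonneg hM n ω)⟩
      have : 0 ≤ ε * n := by positivity
      rw [← h0]
      linarith
    · obtain ⟨δ, hδ, hδε, hδΛ⟩ : ∃ δ > 0, 4 * δ ≤ ε ∧ 8 * δ ≤ Λ :=
        ⟨min (ε / 4) (Λ / 8), by positivity, by linarith [min_le_left (ε / 4) (Λ / 8)],
          by linarith [min_le_right (ε / 4) (Λ / 8)]⟩
      obtain ⟨l, hl0, hl, h1, h2⟩ := hscale δ hδ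
      have hlog2 : 0 < Real.log 2 := Real.log_pos (by norm_num)
      refine ⟨Real.log 2 + K * l + Λ * l, by positivity, fun n ω hω => ?_⟩
      have hdm := Nat.div_add_mod n l
      have hmod := (Nat.mod_lt n hl0).le
      set q := n / l
      set r := n % l
      have e1 := logCocycle_le_add hM hK (q * l) r ω
      have e2 := mul_le_logCocycle_mul hM hδΛ hl h1 h2 q hω
      have hr : (r : ℝ) ≤ l := by exact_mod_cast hmod
      have e4 : K * r ≤ K * l := by gcongr
      have hn : (n : ℝ) = l * q + r := by exact_mod_cast hdm.symm
      rw [mul_comm q l, hdm, mul_comm l q] at e1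
      have e5 : (Λ - ε) * n ≤ (Λ - 4 * δ) * n := by gcongr
      have e6 : (Λ - 4 * δ) * r ≤ Λ * l := by
        have : 0 ≤ δ * r := by positivity
        nlinarith
      rw [hn] at e5 ⊢
      linarith
  refine ⟨C₁ + C₂, fun n ω hω => abs_le.2 ⟨?_, ?_⟩⟩
  · linarith [hlow n ω hω]
  · linarith [hup n ω hω]

end Uniform

/-! ### Linear differential equations with integrable coefficients -/

theorem absolutelyContinuousOnInterval_comp_of_contDiff {φ f : ℝ → ℝ} {a b : ℝ}
    (hφ : ContDiff ℝ 1 φ) (hf : AbsolutelyContinuousOnInterval f a b) :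
    AbsolutelyContinuousOnInterval (φ ∘ f) a b := by
  obtain ⟨C, hC⟩ := hf.exists_bound
  obtain ⟨L, hL⟩ := hφ.contDiffOn.exists_lipschitzOnWith (s := Set.Icc (-C) C) (by decide)
    (convex_Icc _ _) isCompact_Icc
  have hmem : ∀ x ∈ Set.uIcc a b, f x ∈ Set.Icc (-C) C := fun x hx => abs_le.1 (hC x hx)
  rw [absolutelyContinuousOnInterval_iff] at hf ⊢
  intro ε hε
  obtain ⟨δ, hδ, h⟩ := hf (ε / (L + 1)) (by positivity)
  refine ⟨δ, hδ, fun E hE hlt => ?_⟩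
  have h1 := h E hE hlt
  have h2 : ∑ i ∈ Finset.range E.1, dist ((φ ∘ f) (E.2 i).1) ((φ ∘ f) (E.2 i).2) ≤
      (L + 1) * ∑ i ∈ Finset.range E.1, dist (f (E.2 i).1) (f (E.2 i).2) := by
    rw [Finset.mul_sum]
    refine Finset.sum_le_sum fun i hi => ?_
    have hi' := hE.1 i hi
    refine (hL.dist_le_mul _ (hmem _ hi'.1) _ (hmem _ hi'.2)).trans ?_
    gcongr
    linarith
  rw [lt_div_iff₀' (by positivity)] at h1
  linarith

section LinearODE

variable {k : ℝ → ℝ}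

theorem integral_mul_exp_integral (hk : ∀ a b, IntervalIntegrable k volume a b) (x₀ x σ : ℝ) :
    ∫ s in x₀..x, σ * k s * Real.exp (σ * ∫ t in x₀..s, k t) =
      Real.exp (σ * ∫ t in x₀..x, k t) - 1 := by
  have hK : AbsolutelyContinuousOnInterval (fun s => ∫ t in x₀..s, k t) x₀ x :=
    (hk x₀ x).absolutelyContinuousOnInterval_intervalIntegral Set.left_mem_uIcc
  have hH : AbsolutelyContinuousOnInterval (fun s => Real.exp (σ * ∫ t in x₀..s, k t)) x₀ x :=
    absolutelyContinuousOnInterval_comp_of_contDiff (φ := fun y => Real.exp (σ * y))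
      (by fun_prop) hK
  have h := hH.integral_deriv_eq_sub
  simp only [intervalIntegral.integral_same, mul_zero, Real.exp_zero] at h
  rw [← h]
  refine intervalIntegral.integral_congr_ae ?_
  filter_upwards [(hk x₀ x).ae_hasDerivAt_integral] with s hs hsx
  have h1 := hs (Set.uIoc_subset_uIcc hsx) x₀ Set.left_mem_uIcc
  rw [((h1.const_mul σ).exp).deriv]
  ring

/-- The weight `exp (2 |∫ k|)`, adapted to a coefficient of norm `k`. -/
noncomputable def expWeight (k : ℝ → ℝ) (x₀ x : ℝ) : ℝ := Real.exp (2 * |∫ t in x₀..x, k t|)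

theorem expWeight_pos (x₀ x : ℝ) : 0 < expWeight k x₀ x := Real.exp_pos _

theorem one_le_expWeight (x₀ x : ℝ) : 1 ≤ expWeight k x₀ x :=
  Real.one_le_exp (by positivity)

theorem continuous_expWeight (hk : ∀ a b, IntervalIntegrable k volume a b) (x₀ : ℝ) :
    Continuous (expWeight k x₀) :=
  Real.continuous_exp.comp
    ((intervalIntegral.continuous_primitive hk x₀).abs.const_mul 2)

/-- The inequality that makes the integral operator of the differential equation a contraction with
constant `1 / 2` in the weighted supremum norm. -/
theorem abs_integral_mul_expWeight_le (hk : ∀ a b, IntervalIntegrable k volume a b)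
    (hk0 : ∀ x, 0 ≤ k x) (x₀ x : ℝ) :
    |∫ s in x₀..x, k s * expWeight k x₀ s| ≤ expWeight k x₀ x / 2 := by
  rcases le_total x₀ x with h | h
  · have hK : ∀ s ∈ Set.uIcc x₀ x, |∫ t in x₀..s, k t| = ∫ t in x₀..s, k t := fun s hs => by
      rw [Set.uIcc_of_le h] at hs
      exact abs_of_nonneg (intervalIntegral.integral_nonneg_of_forall hs.1 hk0)
    have h1 := integral_mul_exp_integral hk x₀ x 2
    have h2 : ∫ s in x₀..x, k s * expWeight k x₀ s =
        2⁻¹ * ∫ s in x₀..x, 2 * k s * Real.exp (2 * ∫ t in x₀..s, k t) := by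
      rw [← intervalIntegral.integral_const_mul]
      refine intervalIntegral.integral_congr fun s hs => ?_
      simp only [expWeight, hK s hs]
      ring
    have h0 : 0 ≤ ∫ s in x₀..x, k s * expWeight k x₀ s :=
      intervalIntegral.integral_nonneg_of_forall h fun s =>
        mul_nonneg (hk0 s) (expWeight_pos _ _).le
    rw [abs_of_nonneg h0, h2, h1, expWeight, hK x Set.right_mem_uIcc]
    linarith
  · have hK : ∀ s ∈ Set.uIcc x₀ x, |∫ t in x₀..s, k t| = -∫ t in x₀..s, k t := fun s hs => by
      rw [Set.uIcc_of_ge h] at hs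
      rw [intervalIntegral.integral_symm, abs_neg, neg_neg]
      exact abs_of_nonneg (intervalIntegral.integral_nonneg_of_forall hs.2 hk0)
    have h1 := integral_mul_exp_integral hk x₀ x (-2)
    have h2 : ∫ s in x₀..x, k s * expWeight k x₀ s =
        -2⁻¹ * ∫ s in x₀..x, -2 * k s * Real.exp (-2 * ∫ t in x₀..s, k t) := by
      rw [← intervalIntegral.integral_const_mul]
      refine intervalIntegral.integral_congr fun s hs => ?_
      simp only [expWeight, hK s hs]
      ring_nf
    have h0 : ∫ s in x₀..x, k s * expWeight k x₀ s ≤ 0 := by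
      rw [intervalIntegral.integral_symm, neg_nonpos]
      exact intervalIntegral.integral_nonneg_of_forall h fun s =>
        mul_nonneg (hk0 s) (expWeight_pos _ _).le
    have e : 2 * -∫ t in x₀..x, k t = -2 * ∫ t in x₀..x, k t := by ring
    rw [abs_of_nonpos h0, h2, h1, expWeight, hK x Set.right_mem_uIcc, e]
    linarith

variable {R : Type*} [NormedRing R] [NormedAlgebra ℝ R] {b : ℝ → R}

theorem norm_integral_mul_le_expWeight (hb : ∀ x y, IntervalIntegrable b volume x y)
    {u : ℝ → R} {m x₀ x : ℝ} (hm : 0 ≤ m)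
    (hu : ∀ s ∈ Set.uIcc x₀ x, ‖u s‖ ≤ m * expWeight (fun t => ‖b t‖) x₀ s) :
    ‖∫ s in x₀..x, b s * u s‖ ≤ m * (expWeight (fun t => ‖b t‖) x₀ x / 2) := by
  have hk : ∀ x y, IntervalIntegrable (fun t => ‖b t‖) volume x y := fun x y => (hb x y).norm
  have h1 : ‖∫ s in x₀..x, b s * u s‖ ≤
      |∫ s in x₀..x, m * (‖b s‖ * expWeight (fun t => ‖b t‖) x₀ s)| := by
    refine intervalIntegral.norm_integral_le_abs_of_norm_le ?_ ?_
    · refine (ae_restrict_iff' measurableSet_uIoc).2 (ae_of_all _ fun s hs => ?_)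
      refine (norm_mul_le _ _).trans ?_
      rw [mul_left_comm]
      exact mul_le_mul_of_nonneg_left (hu s (Set.uIoc_subset_uIcc hs)) (norm_nonneg _)
    · exact ((hk _ _).mul_continuousOn (continuous_expWeight hk x₀).continuousOn).const_mul m
  rw [intervalIntegral.integral_const_mul, abs_mul, abs_of_nonneg hm] at h1
  exact h1.trans (mul_le_mul_of_nonneg_left
    (abs_integral_mul_expWeight_le hk (fun _ => norm_nonneg _) x₀ x) hm)

/-- Uniqueness for the homogeneous integral equation: the maximum of `‖u‖` relative to the weight is
at most half of itself. -/
theorem eq_zero_of_eq_integral_mul (hb : ∀ x y, IntervalIntegrable b volume x y)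
    {u : ℝ → R} {x₀ x₁ : ℝ} (hu : ContinuousOn u (Set.uIcc x₀ x₁))
    (h : ∀ x ∈ Set.uIcc x₀ x₁, u x = ∫ s in x₀..x, b s * u s) :
    ∀ x ∈ Set.uIcc x₀ x₁, u x = 0 := by
  have hk : ∀ x y, IntervalIntegrable (fun t => ‖b t‖) volume x y := fun x y => (hb x y).norm
  have hcont : ContinuousOn (fun x => ‖u x‖ / expWeight (fun t => ‖b t‖) x₀ x)
      (Set.uIcc x₀ x₁) :=
    hu.norm.div (continuous_expWeight hk x₀).continuousOn fun x _ => (expWeight_pos _ _).ne'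
  obtain ⟨y, hy, hmax⟩ := isCompact_uIcc.exists_isMaxOn ⟨x₀, Set.left_mem_uIcc⟩ hcont
  set m := ‖u y‖ / expWeight (fun t => ‖b t‖) x₀ y with hm
  have hm0 : 0 ≤ m := div_nonneg (norm_nonneg _) (expWeight_pos _ _).le
  have hle : ∀ s ∈ Set.uIcc x₀ x₁, ‖u s‖ ≤ m * expWeight (fun t => ‖b t‖) x₀ s := fun s hs => by
    rw [← div_le_iff₀ (expWeight_pos _ _)]
    exact hmax hs
  have hyle := norm_integral_mul_le_expWeight hb hm0 fun s hs =>
    hle s (Set.uIcc_subset_uIcc_left hy hs)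
  rw [← h y hy] at hyle
  have hmul : ‖u y‖ = m * expWeight (fun t => ‖b t‖) x₀ y := by
    rw [hm, div_mul_cancel₀ _ (expWeight_pos _ _).ne']
  have hw := one_le_expWeight (k := fun t => ‖b t‖) x₀ y
  have hmz : m = 0 := by
    rw [hmul] at hyle
    nlinarith
  intro x hx
  have := hle x hx
  rw [hmz, zero_mul] at this
  exact norm_le_zero_iff.1 this

/-- Every solution is the fundamental solution times its initial value. -/
theorem eq_mul_of_eq_add_integral_mul [CompleteSpace R]
    (hb : ∀ x y, IntervalIntegrable b volume x y) {u Φ : ℝ → R} {c : R} {x₀ x₁ : ℝ}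
    (hu : Continuous u) (hΦ : Continuous Φ)
    (hux : ∀ x ∈ Set.uIcc x₀ x₁, u x = c + ∫ s in x₀..x, b s * u s)
    (hΦx : ∀ x ∈ Set.uIcc x₀ x₁, Φ x = 1 + ∫ s in x₀..x, b s * Φ s) :
    ∀ x ∈ Set.uIcc x₀ x₁, u x = Φ x * c := by
  have hzero := eq_zero_of_eq_integral_mul hb (u := fun s => u s - Φ s * c) (x₀ := x₀) (x₁ := x₁)
    (hu.sub (hΦ.mul continuous_const)).continuousOn fun x hx => by
      have hi1 : IntervalIntegrable (fun r => b r * u r) volume x₀ x :=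
        (hb _ _).mul_continuousOn hu.continuousOn
      have hi2 : IntervalIntegrable (fun r => b r * Φ r) volume x₀ x :=
        (hb _ _).mul_continuousOn hΦ.continuousOn
      have e : ∫ r in x₀..x, b r * Φ r * c = (∫ r in x₀..x, b r * Φ r) * c :=
        ((ContinuousLinearMap.mul ℝ R).flip c).intervalIntegral_comp_comm hi2
      simp only [mul_sub, ← mul_assoc]
      rw [intervalIntegral.integral_sub hi1 (hi2.mul_const c), e, hux x hx, hΦx x hx]
      noncomm_ring
  exact fun x hx => sub_eq_zero.1 (hzero x hx)

/-- Existence of solutions of `A' = b * A` on the whole line, for a locally integrable coefficient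
`b` in a Banach algebra. -/
theorem exists_eq_add_integral_mul [CompleteSpace R]
    (hb : ∀ x y, IntervalIntegrable b volume x y) (x₀ : ℝ) (c : R) :
    ∃ A : ℝ → R, Continuous A ∧ ∀ x, A x = c + ∫ s in x₀..x, b s * A s := by
  have hk : ∀ x y, IntervalIntegrable (fun t => ‖b t‖) volume x y := fun x y => (hb x y).norm
  set w := expWeight (fun t => ‖b t‖) x₀ with hw
  have hwc : Continuous w := continuous_expWeight hk x₀
  have hwpos : ∀ x, 0 < w x := expWeight_pos x₀
  have hw1 : ∀ x, 1 ≤ w x := one_le_expWeight x₀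
  have hint : ∀ u : ℝ → R, Continuous u → ∀ x y,
      IntervalIntegrable (fun s => b s * u s) volume x y := fun u hu x y =>
    (hb x y).mul_continuousOn hu.continuousOn
  have hwz : ∀ z : BoundedContinuousFunction ℝ R, Continuous fun s => w s • z s := fun z =>
    hwc.smul z.continuous
  have hzle : ∀ (z : BoundedContinuousFunction ℝ R) (s : ℝ), ‖w s • z s‖ ≤ ‖z‖ * w s :=
    fun z s => by
      rw [norm_smul, Real.norm_of_nonneg (hwpos s).le, mul_comm]
      exact mul_le_mul_of_nonneg_right (z.norm_coe_le_norm s) (hwpos s).le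
  have hbound : ∀ (z : BoundedContinuousFunction ℝ R) (x : ℝ),
      ‖(w x)⁻¹ • ∫ s in x₀..x, b s * (w s • z s)‖ ≤ ‖z‖ / 2 := by
    intro z x
    rw [norm_smul, norm_inv, Real.norm_of_nonneg (hwpos x).le, inv_mul_le_iff₀ (hwpos x)]
    refine (norm_integral_mul_le_expWeight hb (norm_nonneg z) fun s _ => hzle z s).trans_eq ?_
    rw [← hw]
    ring
  let Φ : BoundedContinuousFunction ℝ R → BoundedContinuousFunction ℝ R := fun z =>
    BoundedContinuousFunction.ofNormedAddCommGroup
      (fun x => (w x)⁻¹ • (c + ∫ s in x₀..x, b s * (w s • z s)))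
      ((hwc.inv₀ fun x => (hwpos x).ne').smul
        (continuous_const.add (intervalIntegral.continuous_primitive (hint _ (hwz z)) x₀)))
      (‖c‖ + ‖z‖ / 2) (fun x => by
        rw [smul_add]
        refine (norm_add_le _ _).trans (add_le_add ?_ (hbound z x))
        rw [norm_smul, norm_inv, Real.norm_of_nonneg (hwpos x).le, inv_mul_le_iff₀ (hwpos x)]
        exact le_mul_of_one_le_left (norm_nonneg _) (hw1 x))
  have hΦ : ContractingWith (1 / 2) Φ := by
    refine ⟨by rw [← NNReal.coe_lt_coe]; norm_num, LipschitzWith.of_dist_le_mul fun z z' => ?_⟩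
    rw [BoundedContinuousFunction.dist_le (by positivity)]
    intro x
    have h := hbound (z - z') x
    have e : (Φ z) x - (Φ z') x = (w x)⁻¹ • ∫ s in x₀..x, b s * (w s • (z - z') s) := by
      change (w x)⁻¹ • (c + ∫ s in x₀..x, b s * (w s • z s)) -
        (w x)⁻¹ • (c + ∫ s in x₀..x, b s * (w s • z' s)) = _
      rw [← smul_sub, add_sub_add_left_eq_sub,
        ← intervalIntegral.integral_sub (hint _ (hwz z) _ _) (hint _ (hwz z') _ _)]
      congr 2
      ext s
      rw [BoundedContinuousFunction.coe_sub, Pi.sub_apply, smul_sub, mul_sub]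
    rw [dist_eq_norm, e, dist_eq_norm]
    refine h.trans_eq ?_
    push_cast
    ring
  have hfix : Φ hΦ.fixedPoint = hΦ.fixedPoint := hΦ.fixedPoint_isFixedPt
  set z := hΦ.fixedPoint
  refine ⟨fun s => w s • z s, hwz z, fun x => ?_⟩
  have h : (w x)⁻¹ • (c + ∫ s in x₀..x, b s * (w s • z s)) = z x :=
    congrArg (fun y : BoundedContinuousFunction ℝ R => y x) hfix
  change w x • z x = _
  rw [← h, smul_inv_smul₀ (hwpos x).ne']

end LinearODE

section Transfer

variable {V : ℝ → ℝ} {E x₀ : ℝ}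


theorem continuous_toEuclideanCLM : Continuous toCLM :=
  LinearMap.continuous_of_finiteDimensional (toCLM).toAlgEquiv.toLinearMap

theorem continuous_toEuclideanCLM_symm : Continuous (toCLM).symm :=
  LinearMap.continuous_of_finiteDimensional (toCLM).symm.toAlgEquiv.toLinearMap

theorem intervalIntegrable_toEuclideanCLM_coeffMatrix
    (hV : ∀ x y, IntervalIntegrable V volume x y) (E x y : ℝ) :
    IntervalIntegrable (fun s => toCLM (coeffMatrix V E s)) volume x y := by
  have e : (fun s => toCLM (coeffMatrix V E s)) =
      fun s => toCLM !![0, -E; 1, 0] + V s • toCLM !![0, 1; 0, 0] := by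
    ext1 s
    rw [← map_smul, ← map_add]
    congr 1
    ext i j
    fin_cases i <;> fin_cases j <;> simp [coeffMatrix]
    ring
  rw [e]
  exact intervalIntegrable_const.add ((hV x y).smul_continuousOn continuousOn_const)

/-- The Carathéodory equation, as an equation in the Banach algebra of operators on the plane. -/
theorem isTransferMatrix_iff (hV : ∀ x y, IntervalIntegrable V volume x y)
    {A : ℝ → Matrix (Fin 2) (Fin 2) ℝ} :
    IsTransferMatrix V E x₀ A ↔ Continuous (fun x => toCLM (A x)) ∧
      ∀ x, toCLM (A x) = 1 + ∫ s in x₀..x, toCLM (coeffMatrix V E s) * toCLM (A s) := by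
  have hcont : Continuous A ↔ Continuous fun x => toCLM (A x) :=
    ⟨fun h => continuous_toEuclideanCLM.comp h, fun h => by
      have := continuous_toEuclideanCLM_symm.comp h
      simpa [Function.comp_def] using this⟩
  rw [IsTransferMatrix, ← hcont]
  refine and_congr_right fun hA => forall_congr' fun x => ?_
  have hint : IntervalIntegrable (fun s => toCLM (coeffMatrix V E s) * toCLM (A s)) volume x₀ x :=
    (intervalIntegrable_toEuclideanCLM_coeffMatrix hV E x₀ x).mul_continuousOn
      (hcont.1 hA).continuousOn
  have hentry : ∀ i j, (toCLM).symm
      (∫ s in x₀..x, toCLM (coeffMatrix V E s) * toCLM (A s)) i j =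
        ∫ s in x₀..x, (coeffMatrix V E s * A s) i j := by
    intro i j
    let L : (EuclideanSpace ℝ (Fin 2) →L[ℝ] EuclideanSpace ℝ (Fin 2)) →L[ℝ] ℝ :=
      LinearMap.toContinuousLinearMap
        (Matrix.entryLinearMap ℝ ℝ i j ∘ₗ (toCLM).symm.toAlgEquiv.toLinearMap)
    have h := L.intervalIntegral_comp_comm hint
    have hL : ∀ T, L T = (toCLM).symm T i j := fun T => rfl
    simp only [hL, ← map_mul, StarAlgEquiv.symm_apply_apply] at h
    simp only [← map_mul]
    exact h.symm
  have hsymm : ∀ T, toCLM (A x) = T ↔ A x = (toCLM).symm T := fun T =>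
    ⟨fun h => by rw [← h, StarAlgEquiv.symm_apply_apply],
      fun h => by rw [h, StarAlgEquiv.apply_symm_apply]⟩
  rw [hsymm, map_add, map_one, ← Matrix.ext_iff]
  simp only [Matrix.add_apply, hentry]

theorem exists_isTransferMatrix (hV : ∀ x y, IntervalIntegrable V volume x y) (E x₀ : ℝ) :
    ∃ A, IsTransferMatrix V E x₀ A := by
  obtain ⟨B, hB, hBx⟩ := exists_eq_add_integral_mul
    (intervalIntegrable_toEuclideanCLM_coeffMatrix hV E) x₀ 1
  refine ⟨fun x => (toCLM).symm (B x), (isTransferMatrix_iff hV).2 ?_⟩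
  simp only [StarAlgEquiv.apply_symm_apply]
  exact ⟨hB, hBx⟩

theorem IsTransferMatrix.det_eq_one (hV : ∀ x y, IntervalIntegrable V volume x y)
    {A : ℝ → Matrix (Fin 2) (Fin 2) ℝ} (hA : IsTransferMatrix V E x₀ A) (x : ℝ) :
    (A x).det = 1 := by
  have hent : ∀ i j, Continuous fun s => A s i j := fun i j => hA.1.matrix_elem i j
  have hint : ∀ i j, IntervalIntegrable (fun s => (coeffMatrix V E s * A s) i j) volume x₀ x := by
    intro i j
    simp only [Matrix.mul_apply, Fin.sum_univ_two]
    fin_cases i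
    · simp only [coeffMatrix, Fin.zero_eta, Matrix.of_apply, Matrix.cons_val', Matrix.cons_val_zero,
        Matrix.cons_val_one, zero_mul, zero_add]
      exact (((hV x₀ x).sub intervalIntegrable_const).mul_continuousOn (hent 1 j).continuousOn)
    · simp only [coeffMatrix, Fin.mk_one, Matrix.of_apply, Matrix.cons_val', Matrix.cons_val_zero,
        Matrix.cons_val_one, zero_mul, add_zero, one_mul]
      exact (hent 0 j).intervalIntegrable _ _
  have hfun : ∀ i j, (fun s => A s i j) = fun s =>
      (1 : Matrix (Fin 2) (Fin 2) ℝ) i j + ∫ t in x₀..s, (coeffMatrix V E t * A t) i j :=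
    fun i j => funext fun s => hA.2 s i j
  have hac : ∀ i j, AbsolutelyContinuousOnInterval (fun s => A s i j) x₀ x := by
    intro i j
    rw [hfun i j]
    exact (LipschitzOnWith.absolutelyContinuousOnInterval
      (LipschitzWith.const ((1 : Matrix (Fin 2) (Fin 2) ℝ) i j)).lipschitzOnWith).add
      ((hint i j).absolutelyContinuousOnInterval_intervalIntegral Set.left_mem_uIcc)
  have hder : ∀ i j, ∀ᵐ s, s ∈ Set.uIcc x₀ x →
      HasDerivAt (fun s => A s i j) ((coeffMatrix V E s * A s) i j) s := by
    intro i j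
    filter_upwards [(hint i j).ae_hasDerivAt_integral] with s hs hsx
    rw [hfun i j]
    exact (hs hsx x₀ Set.left_mem_uIcc).const_add _
  have hdet : AbsolutelyContinuousOnInterval (fun s => (A s).det) x₀ x := by
    simp only [Matrix.det_fin_two]
    exact ((hac 0 0).mul (hac 1 1)).sub ((hac 0 1).mul (hac 1 0))
  obtain ⟨C, hC⟩ := hdet.const_of_ae_hasDerivAt_zero (by
    filter_upwards [hder 0 0, hder 0 1, hder 1 0, hder 1 1] with s h1 h2 h3 h4 hs
    simp only [Matrix.det_fin_two]
    have h := ((h1 hs).mul (h4 hs)).sub ((h2 hs).mul (h3 hs))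
    refine h.congr_deriv ?_
    simp only [Matrix.mul_apply, Fin.sum_univ_two, coeffMatrix]
    simp
    ring)
  have h0 : A x₀ = 1 := by
    ext i j
    rw [hA.2 x₀ i j]
    simp
  rw [hC x Set.right_mem_uIcc, ← hC x₀ Set.left_mem_uIcc, h0, Matrix.det_one]

end Transfer

/-! ### Concatenated potentials -/

section LeftEnd

variable {𝒜 : Type*} (P : Pieces 𝒜) (ω : ℤ → 𝒜)

theorem leftEnd_zero : leftEnd P ω 0 = 0 := by simp [leftEnd]

theorem leftEnd_add_one (n : ℤ) : leftEnd P ω (n + 1) = leftEnd P ω n + P.length (ω n) := by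
  unfold leftEnd
  rcases lt_or_ge n 0 with h | h
  · have e1 : Finset.Ico n 0 = insert n (Finset.Ico (n + 1) 0) := by
      ext k; simp only [Finset.mem_Ico, Finset.mem_insert]; omega
    have e2 : Finset.Ico 0 n = ∅ := Finset.Ico_eq_empty (by omega)
    have e3 : Finset.Ico 0 (n + 1) = ∅ := Finset.Ico_eq_empty (by omega)
    rw [e1, e2, e3, Finset.sum_insert (by simp)]
    ring
  · have e1 : Finset.Ico 0 (n + 1) = insert n (Finset.Ico 0 n) := by
      ext k; simp only [Finset.mem_Ico, Finset.mem_insert]; omega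
    have e2 : Finset.Ico n 0 = ∅ := Finset.Ico_eq_empty (by omega)
    have e3 : Finset.Ico (n + 1) 0 = ∅ := Finset.Ico_eq_empty (by omega)
    rw [e1, e2, e3, Finset.sum_insert (by simp)]
    ring

theorem strictMono_leftEnd : StrictMono (leftEnd P ω) :=
  strictMono_int_of_lt_succ fun n => by
    rw [leftEnd_add_one]
    linarith [P.length_pos (ω n)]

theorem exists_length_bounds [Finite 𝒜] :
    ∃ r > 0, ∃ S > 0, ∀ a, r ≤ P.length a ∧ P.length a ≤ S := by
  obtain ⟨S, hS⟩ := (Set.finite_range P.length).bddAbove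
  obtain ⟨S', hS'⟩ := (Set.finite_range fun a => (P.length a)⁻¹).bddAbove
  refine ⟨(max S' 1)⁻¹, by positivity, max S 1, by positivity, fun a => ⟨?_, ?_⟩⟩
  · have h : (P.length a)⁻¹ ≤ max S' 1 := (hS' ⟨a, rfl⟩).trans (le_max_left _ _)
    exact inv_le_of_inv_le₀ (P.length_pos a) h
  · exact (hS ⟨a, rfl⟩).trans (le_max_left _ _)

variable {P ω}

theorem mul_le_leftEnd_natCast {r : ℝ} (hr : ∀ a, r ≤ P.length a) (n : ℕ) :
    n * r ≤ leftEnd P ω n := by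
  induction n with
  | zero => simp [leftEnd_zero]
  | succ n ih =>
    push_cast
    rw [leftEnd_add_one]
    linarith [hr (ω n)]

theorem mul_le_neg_leftEnd_neg {r : ℝ} (hr : ∀ a, r ≤ P.length a) (n : ℕ) :
    n * r ≤ -leftEnd P ω (-n) := by
  induction n with
  | zero => simp [leftEnd_zero]
  | succ n ih =>
    have h := leftEnd_add_one P ω (-(n + 1 : ℕ))
    rw [show (-((n + 1 : ℕ) : ℤ) + 1) = -n by push_cast; ring] at h
    push_cast at *
    linarith [hr (ω (-1 + -(n : ℤ))), hr (ω (-((n : ℤ) + 1)))]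

theorem neg_leftEnd_neg_le_mul {S : ℝ} (hS : ∀ a, P.length a ≤ S) (n : ℕ) :
    -leftEnd P ω (-n) ≤ n * S := by
  induction n with
  | zero => simp [leftEnd_zero]
  | succ n ih =>
    have h := leftEnd_add_one P ω (-(n + 1 : ℕ))
    rw [show (-((n + 1 : ℕ) : ℤ) + 1) = -n by push_cast; ring] at h
    have := hS (ω (-(n + 1 : ℕ)))
    push_cast at *
    linarith

theorem exists_le_leftEnd [Finite 𝒜] (x : ℝ) : ∃ n : ℕ, x ≤ leftEnd P ω n := by
  obtain ⟨r, hr, _, _, h⟩ := exists_length_bounds P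
  obtain ⟨n, hn⟩ := exists_nat_ge (x / r)
  rw [div_le_iff₀ hr] at hn
  exact ⟨n, hn.trans (mul_le_leftEnd_natCast (fun a => (h a).1) n)⟩

theorem exists_leftEnd_neg_le [Finite 𝒜] (x : ℝ) : ∃ n : ℕ, leftEnd P ω (-n) ≤ x := by
  obtain ⟨r, hr, _, _, h⟩ := exists_length_bounds P
  obtain ⟨n, hn⟩ := exists_nat_ge (-x / r)
  rw [div_le_iff₀ hr] at hn
  have := hn.trans (mul_le_neg_leftEnd_neg (ω := ω) (fun a => (h a).1) n)
  exact ⟨n, by linarith⟩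

theorem exists_mem_piece_of_nonneg [Finite 𝒜] {x : ℝ} (hx : 0 ≤ x) :
    ∃ n : ℕ, leftEnd P ω n ≤ x ∧ x < leftEnd P ω (n + 1) := by
  classical
  obtain ⟨N, hN⟩ := exists_le_leftEnd (P := P) (ω := ω) (x + 1)
  have hex : ∃ n : ℕ, x < leftEnd P ω n := ⟨N, by linarith⟩
  have h0 : Nat.find hex ≠ 0 := fun h => by
    have := Nat.find_spec hex
    rw [h, Nat.cast_zero, leftEnd_zero] at this
    linarith
  obtain ⟨m, hm⟩ := Nat.exists_eq_succ_of_ne_zero h0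
  refine ⟨m, not_lt.1 (Nat.find_min hex (by omega)), ?_⟩
  have := Nat.find_spec hex
  rw [hm] at this
  exact_mod_cast this

theorem exists_mem_piece_of_neg [Finite 𝒜] {x : ℝ} (hx : x < 0) :
    ∃ n : ℕ, leftEnd P ω (-n) ≤ x ∧ x ≤ leftEnd P ω (-n + 1) := by
  classical
  have hex := exists_leftEnd_neg_le (P := P) (ω := ω) x
  have h0 : Nat.find hex ≠ 0 := fun h => by
    have := Nat.find_spec hex
    rw [h, Nat.cast_zero, neg_zero, leftEnd_zero] at this
    linarith
  obtain ⟨m, hm⟩ := Nat.exists_eq_succ_of_ne_zero h0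
  refine ⟨Nat.find hex, Nat.find_spec hex, ?_⟩
  have := not_le.1 (Nat.find_min hex (m := m) (by omega))
  rw [hm, show -((m.succ : ℕ) : ℤ) + 1 = -m by push_cast; ring]
  exact this.le

theorem potential_of_mem {n : ℤ} {x : ℝ}
    (hx : x ∈ Set.Ico (leftEnd P ω n) (leftEnd P ω (n + 1))) :
    potential P ω x = P.piece (ω n) (x - leftEnd P ω n) := by
  rw [potential, finsum_eq_single _ n, Set.indicator_of_mem hx]
  intro m hm
  refine Set.indicator_of_notMem (fun hxm => hm ?_) _
  have h1 := (strictMono_leftEnd P ω).lt_iff_lt.1 (hxm.1.trans_lt hx.2)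
  have h2 := (strictMono_leftEnd P ω).lt_iff_lt.1 (hx.1.trans_lt hxm.2)
  omega

theorem integrableOn_piece (a : 𝒜) : IntegrableOn (P.piece a) (Set.Ioo 0 (P.length a)) :=
  (P.memLp_piece a).integrable (by norm_num)

theorem intervalIntegrable_piece (a : 𝒜) :
    IntervalIntegrable (P.piece a) volume 0 (P.length a) := by
  rw [intervalIntegrable_iff_integrableOn_Ioo_of_le (P.length_pos a).le]
  exact integrableOn_piece a

theorem intervalIntegrable_potential_piece (n : ℤ) :
    IntervalIntegrable (potential P ω) volume (leftEnd P ω n) (leftEnd P ω (n + 1)) := by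
  have h := (intervalIntegrable_piece (P := P) (ω n)).comp_sub_right (leftEnd P ω n)
  rw [zero_add, add_comm (P.length _), ← leftEnd_add_one] at h
  have hle := ((strictMono_leftEnd P ω) (lt_add_one n)).le
  rw [intervalIntegrable_iff_integrableOn_Ioo_of_le hle] at h ⊢
  exact h.congr_fun (fun x hx => (potential_of_mem ⟨hx.1.le, hx.2⟩).symm) measurableSet_Ioo

theorem intervalIntegrable_potential [Finite 𝒜] (x y : ℝ) :
    IntervalIntegrable (potential P ω) volume x y := by
  have h : ∀ (m : ℤ) (n : ℕ),
      IntervalIntegrable (potential P ω) volume (leftEnd P ω m) (leftEnd P ω (m + n)) := by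
    intro m n
    induction n with
    | zero => simp
    | succ n ih =>
      have := ih.trans (intervalIntegrable_potential_piece (m + n))
      push_cast
      rwa [← add_assoc]
  obtain ⟨m, hm⟩ := exists_leftEnd_neg_le (P := P) (ω := ω) (min x y)
  obtain ⟨n, hn⟩ := exists_le_leftEnd (P := P) (ω := ω) (max x y)
  have h1 := h (-m) (m + n)
  rw [show -(m : ℤ) + (m + n : ℕ) = n by push_cast; ring] at h1
  refine h1.mono_set ?_
  rw [Set.uIcc_of_le ((hm.trans (min_le_max)).trans hn)]
  exact Set.Icc_subset_Icc hm hn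

end LeftEnd

section Glue

variable {𝒜 : Type*} {P : Pieces 𝒜} {ω : ℤ → 𝒜}

/-- The potential piece of the letter `a`, extended by zero to the line. -/
noncomputable def extendedPiece (P : Pieces 𝒜) (a : 𝒜) : ℝ → ℝ :=
  (Set.Ioo 0 (P.length a)).indicator (P.piece a)

theorem intervalIntegrable_extendedPiece (a : 𝒜) (x y : ℝ) :
    IntervalIntegrable (extendedPiece P a) volume x y :=
  ((integrable_indicator_iff measurableSet_Ioo).2 (integrableOn_piece a)).intervalIntegrable

/-- The transfer matrix, started at `0`, of the potential piece of the letter `a`. Only its values on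
`[0, ℓ_a]` matter. -/
noncomputable def pieceSolution (P : Pieces 𝒜) (E : ℝ) (a : 𝒜) :
    ℝ → Matrix (Fin 2) (Fin 2) ℝ :=
  (exists_isTransferMatrix (intervalIntegrable_extendedPiece (P := P) a) E 0).choose

theorem isTransferMatrix_pieceSolution (P : Pieces 𝒜) (E : ℝ) (a : 𝒜) :
    IsTransferMatrix (extendedPiece P a) E 0 (pieceSolution P E a) :=
  (exists_isTransferMatrix (intervalIntegrable_extendedPiece (P := P) a) E 0).choose_spec

theorem det_pieceSolution (P : Pieces 𝒜) (E : ℝ) (a : 𝒜) (t : ℝ) :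
    (pieceSolution P E a t).det = 1 :=
  (isTransferMatrix_pieceSolution P E a).det_eq_one (intervalIntegrable_extendedPiece a) t

theorem exists_pieceSolution_bound [Finite 𝒜] (P : Pieces 𝒜) (E : ℝ) :
    ∃ D : ℝ, ∀ a, ∀ t ∈ Set.Icc 0 (P.length a), ‖pieceSolution P E a t‖ ≤ Real.exp D := by
  have h : ∀ a, ∃ D, ∀ t ∈ Set.Icc 0 (P.length a), opNorm (pieceSolution P E a t) ≤ D := by
    intro a
    obtain ⟨D, hD⟩ := (isCompact_Icc (a := 0) (b := P.length a)).exists_bound_of_continuousOn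
      (continuous_opNorm.comp (isTransferMatrix_pieceSolution P E a).1).continuousOn
    exact ⟨D, fun t ht => (le_abs_self _).trans (hD t ht)⟩
  choose D hD using h
  obtain ⟨B, hB⟩ := (Set.finite_range D).bddAbove
  refine ⟨Real.log (max (2 * B) 1), fun a t ht => ?_⟩
  rw [Real.exp_log (by positivity)]
  refine (norm_le_two_mul_opNorm _).trans (le_trans ?_ (le_max_left _ _))
  linarith [hD a t ht, hB ⟨a, rfl⟩]

theorem isTransferMatrix_transferMatrix [Finite 𝒜] (P : Pieces 𝒜) (E : ℝ) (ω : ℤ → 𝒜) (x₀ : ℝ) :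
    IsTransferMatrix (potential P ω) E x₀ fun x => transferMatrix P E ω x x₀ := by
  have h : ∃ A, IsTransferMatrix (potential P ω) E x₀ A :=
    exists_isTransferMatrix intervalIntegrable_potential E x₀
  have e : (fun x => transferMatrix P E ω x x₀) = h.choose := by
    ext x
    rw [transferMatrix, dif_pos h]
  rw [e]
  exact h.choose_spec

theorem det_transferMatrix [Finite 𝒜] (P : Pieces 𝒜) (E : ℝ) (ω : ℤ → 𝒜) (x x₀ : ℝ) :
    (transferMatrix P E ω x x₀).det = 1 :=
  (isTransferMatrix_transferMatrix P E ω x₀).det_eq_one intervalIntegrable_potential x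

theorem transferMatrix_self [Finite 𝒜] (P : Pieces 𝒜) (E : ℝ) (ω : ℤ → 𝒜) (x₀ : ℝ) :
    transferMatrix P E ω x₀ x₀ = 1 := by
  ext i j
  have h := (isTransferMatrix_transferMatrix P E ω x₀).2 x₀ i j
  simpa using h


/-- Across a letter `a` the transfer matrix evolves by the solution `pieceSolution P E a`, which
does not depend on the position. -/
theorem transferMatrix_leftEnd_add [Finite 𝒜] (P : Pieces 𝒜) (E : ℝ) (ω : ℤ → 𝒜) (x₀ : ℝ)
    (n : ℤ) {t : ℝ} (ht : t ∈ Set.Icc 0 (P.length (ω n))) :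
    transferMatrix P E ω (leftEnd P ω n + t) x₀ =
      pieceSolution P E (ω n) t * transferMatrix P E ω (leftEnd P ω n) x₀ := by
  set a := ω n
  set y := leftEnd P ω n
  set A := fun x => toCLM (transferMatrix P E ω x x₀) with hAdef
  have hV : ∀ x y, IntervalIntegrable (potential P ω) volume x y := intervalIntegrable_potential
  have hW : ∀ x y, IntervalIntegrable (extendedPiece P a) volume x y :=
    intervalIntegrable_extendedPiece a
  obtain ⟨hAc, hA⟩ := (isTransferMatrix_iff hV).1 (isTransferMatrix_transferMatrix P E ω x₀)
  obtain ⟨hΦc, hΦ⟩ := (isTransferMatrix_iff hW).1 (isTransferMatrix_pieceSolution P E a)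
  have hb := intervalIntegrable_toEuclideanCLM_coeffMatrix hW E
  have hB := intervalIntegrable_toEuclideanCLM_coeffMatrix hV E
  set b := fun s => toCLM (coeffMatrix (extendedPiece P a) E s) with hbdef
  have hAc' : Continuous fun s => A (y + s) := hAc.comp (continuous_const.add continuous_id)
  have hAy : ∀ s ∈ Set.uIcc 0 (P.length a), A (y + s) = A y + ∫ r in (0 : ℝ)..s, b r * A (y + r) := by
    intro s hs
    rw [Set.uIcc_of_le (P.length_pos a).le] at hs
    have e1 : A (y + s) - A y = ∫ r in y..(y + s), toCLM (coeffMatrix (potential P ω) E r) * A r := by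
      simp only [hAdef]
      rw [hA (y + s), hA y, add_sub_add_left_eq_sub]
      exact intervalIntegral.integral_interval_sub_left
        ((hB _ _).mul_continuousOn hAc.continuousOn) ((hB _ _).mul_continuousOn hAc.continuousOn)
    have e2 : ∫ r in (0 : ℝ)..s, b r * A (y + r) =
        ∫ r in (0 : ℝ)..s, toCLM (coeffMatrix (potential P ω) E (y + r)) * A (y + r) := by
      rw [intervalIntegral.integral_of_le hs.1, intervalIntegral.integral_of_le hs.1,
        integral_Ioc_eq_integral_Ioo, integral_Ioc_eq_integral_Ioo]
      refine setIntegral_congr_fun measurableSet_Ioo fun r hr => ?_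
      have hr' : r ∈ Set.Ioo 0 (P.length a) := ⟨hr.1, hr.2.trans_le hs.2⟩
      have hpot : potential P ω (y + r) = extendedPiece P a r := by
        rw [potential_of_mem (n := n) ⟨by linarith [hr.1], by
          rw [leftEnd_add_one]; linarith [hr'.2]⟩, add_sub_cancel_left, extendedPiece,
          Set.indicator_of_mem hr']
      simp only [hbdef, coeffMatrix, hpot]
    rw [e2, intervalIntegral.integral_comp_add_left
      (fun r => toCLM (coeffMatrix (potential P ω) E r) * A r), add_zero, ← e1]
    abel
  have h := eq_mul_of_eq_add_integral_mul hb hAc' hΦc hAy (fun s _ => hΦ s) t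
    (by rwa [Set.uIcc_of_le (P.length_pos a).le])
  simp only [hAdef, ← map_mul] at h
  exact (toCLM).injective h

end Glue

/-! ### Uniform growth of the transfer matrices -/

section Monodromy

variable {𝒜 : Type*} (P : Pieces 𝒜) (E : ℝ) (ω : ℤ → 𝒜)

/-- The transfer matrix `M a` across the letter `a`. -/
noncomputable def letterMatrix (a : 𝒜) :
    Matrix (Fin 2) (Fin 2) ℝ :=
  pieceSolution P E a (P.length a)

theorem det_letterMatrix (a : 𝒜) : (letterMatrix P E a).det = 1 := det_pieceSolution P E a _

variable [Finite 𝒜]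

theorem transferMatrix_leftEnd_add_natCast (x₀ : ℝ) (n : ℤ) (m : ℕ) :
    transferMatrix P E ω (leftEnd P ω (n + m)) x₀ =
      cocycle (letterMatrix P E) m (shift n ω) * transferMatrix P E ω (leftEnd P ω n) x₀ := by
  induction m with
  | zero => simp [cocycle, orderedProd]
  | succ m ih =>
    have h := transferMatrix_leftEnd_add P E ω x₀ (n + m)
      (Set.right_mem_Icc.2 (P.length_pos _).le)
    rw [← leftEnd_add_one, ih] at h
    rw [cocycle_succ, mul_assoc]
    push_cast
    rw [← add_assoc]
    exact h

theorem transferMatrix_leftEnd_natCast (m : ℕ) :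
    transferMatrix P E ω (leftEnd P ω m) 0 = cocycle (letterMatrix P E) m ω := by
  have h := transferMatrix_leftEnd_add_natCast P E ω 0 0 m
  rwa [zero_add, leftEnd_zero, transferMatrix_self, mul_one, shift_zero] at h

theorem transferMatrix_leftEnd_neg (m : ℕ) :
    transferMatrix P E ω (leftEnd P ω (-m)) 0 =
      (cocycle (letterMatrix P E) m (shift (-m : ℤ) ω)).adjugate := by
  have h := transferMatrix_leftEnd_add_natCast P E ω 0 (-m) m
  rw [neg_add_cancel, leftEnd_zero, transferMatrix_self] at h
  have hd := det_cocycle (det_letterMatrix P E) m (shift (-m : ℤ) ω)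
  have h2 := congrArg (fun B => (cocycle (letterMatrix P E) m (shift (-m : ℤ) ω)).adjugate * B) h
  simp only [mul_one, ← mul_assoc, Matrix.adjugate_mul] at h2
  rw [h2, hd, one_smul, one_mul]

variable {P E}

theorem abs_log_transferMatrix_sub_le {D : ℝ}
    (hD : ∀ a, ∀ t ∈ Set.Icc 0 (P.length a), ‖pieceSolution P E a t‖ ≤ Real.exp D) (n : ℤ)
    {x : ℝ} (hx : leftEnd P ω n ≤ x) (hx' : x ≤ leftEnd P ω (n + 1)) :
    |Real.log (opNorm (transferMatrix P E ω x 0)) -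
      Real.log (opNorm (transferMatrix P E ω (leftEnd P ω n) 0))| ≤ D := by
  rw [leftEnd_add_one] at hx'
  have ht : x - leftEnd P ω n ∈ Set.Icc 0 (P.length (ω n)) := ⟨by linarith, by linarith⟩
  have h := transferMatrix_leftEnd_add P E ω 0 n ht
  rw [add_sub_cancel] at h
  have hdet := det_transferMatrix P E ω
  have hΦ := hD _ _ ht
  have hdΦ := det_pieceSolution P E (ω n) (x - leftEnd P ω n)
  set Φ := pieceSolution P E (ω n) (x - leftEnd P ω n)
  have h1 := log_opNorm_mul_le ((opNorm_le_norm _).trans hΦ) (hdet (leftEnd P ω n) 0)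
    (by rw [← h]; exact hdet x 0)
  rw [← h] at h1
  have h' : transferMatrix P E ω (leftEnd P ω n) 0 =
      Φ.adjugate * transferMatrix P E ω x 0 := by
    rw [h, ← mul_assoc, Matrix.adjugate_mul, hdΦ, one_smul, one_mul]
  have h2 := log_opNorm_mul_le
    ((opNorm_le_norm _).trans ((norm_adjugate_fin_two Φ).trans_le hΦ)) (hdet x 0)
    (by rw [← h']; exact hdet _ 0)
  rw [← h'] at h2
  rw [abs_le]
  constructor <;> linarith

/-- To the left of the origin the transfer matrix is the inverse of a cocycle; the term `log 2` pays
for the passage between the operator norm and the Frobenius norm, which is invariant under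
inversion in `SL(2, ℝ)`. -/
theorem logCocycle_le_log_transferMatrix_neg (m : ℕ) :
    logCocycle (letterMatrix P E) m (shift (-m : ℤ) ω) ≤
      Real.log (opNorm (transferMatrix P E ω (leftEnd P ω (-m)) 0)) + Real.log 2 := by
  have hdet := det_transferMatrix P E ω (leftEnd P ω (-m)) 0
  have h1 := one_le_opNorm_of_det_eq_one hdet
  have hpos := opNorm_cocycle_pos (det_letterMatrix P E) m (shift (-m : ℤ) ω)
  rw [logCocycle, ← Real.log_mul (by positivity) (by norm_num)]
  refine Real.log_le_log hpos ?_
  rw [transferMatrix_leftEnd_neg]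
  refine (opNorm_le_norm _).trans ((norm_adjugate_fin_two _).symm.trans_le ?_)
  rw [mul_comm]
  exact norm_le_two_mul_opNorm _

end Monodromy

section LengthCocycle

variable {𝒜 : Type*} (P : Pieces 𝒜) (ω : ℤ → 𝒜)

/-- The unimodular matrices `diag (e^{ℓ_a}, e^{-ℓ_a})`, whose cocycle encodes the lengths `x_n`. -/
noncomputable def lengthMatrix (P : Pieces 𝒜) (a : 𝒜) : Matrix (Fin 2) (Fin 2) ℝ :=
  !![Real.exp (P.length a), 0; 0, Real.exp (-P.length a)]

theorem det_lengthMatrix (a : 𝒜) : (lengthMatrix P a).det = 1 := by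
  rw [lengthMatrix, Matrix.det_fin_two_of, ← Real.exp_add]
  simp

theorem cocycle_lengthMatrix (n : ℕ) :
    cocycle (lengthMatrix P) n ω =
      !![Real.exp (leftEnd P ω n), 0; 0, Real.exp (-leftEnd P ω n)] := by
  induction n with
  | zero => simp [cocycle, orderedProd, leftEnd_zero, Matrix.one_fin_two]
  | succ n ih =>
    rw [cocycle_succ, ih, lengthMatrix, Matrix.mul_fin_two]
    push_cast
    rw [leftEnd_add_one, neg_add, Real.exp_add, Real.exp_add]
    simp [mul_comm]

theorem abs_logCocycle_lengthMatrix_sub_le (n : ℕ) :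
    |logCocycle (lengthMatrix P) n ω - leftEnd P ω n| ≤ Real.log 2 := by
  set y := leftEnd P ω n with hy
  have hy0 : 0 ≤ y := by
    have := (strictMono_leftEnd P ω).monotone (Int.natCast_nonneg n)
    rwa [leftEnd_zero] at this
  have hsq := frobenius_norm_sq_fin_two (cocycle (lengthMatrix P) n ω)
  have hentries : ‖cocycle (lengthMatrix P) n ω‖ ^ 2 = Real.exp y ^ 2 + Real.exp (-y) ^ 2 := by
    rw [hsq, cocycle_lengthMatrix]
    simp [hy]
  have h1 := opNorm_le_norm (cocycle (lengthMatrix P) n ω)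
  have h2 := norm_le_two_mul_opNorm (cocycle (lengthMatrix P) n ω)
  have hpos := opNorm_cocycle_pos (det_lengthMatrix P) n ω
  have hey := Real.exp_pos y
  have hle : Real.exp (-y) ≤ Real.exp y := Real.exp_le_exp.2 (by linarith)
  have hey' := Real.exp_pos (-y)
  have hlow : Real.exp y ≤ ‖cocycle (lengthMatrix P) n ω‖ := by
    refine (sq_le_sq₀ hey.le (norm_nonneg _)).1 ?_
    nlinarith
  have hup : ‖cocycle (lengthMatrix P) n ω‖ ≤ 2 * Real.exp y := by
    refine (sq_le_sq₀ (norm_nonneg _) (by positivity)).1 ?_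
    nlinarith
  have hexp2 : Real.exp (Real.log 2) = 2 := Real.exp_log (by norm_num)
  rw [abs_le, logCocycle]
  constructor
  · have : y - Real.log 2 ≤ Real.log (opNorm (cocycle (lengthMatrix P) n ω)) := by
      rw [Real.le_log_iff_exp_le hpos, Real.exp_sub, hexp2]
      linarith
    linarith
  · have : Real.log (opNorm (cocycle (lengthMatrix P) n ω)) ≤ Real.log 2 + y := by
      rw [Real.log_le_iff_le_exp hpos, Real.exp_add, hexp2]
      linarith
    linarith

end LengthCocycle

section Main

variable {𝒜 : Type*} [Finite 𝒜] [TopologicalSpace 𝒜] [DiscreteTopology 𝒜]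
  [MeasurableSpace 𝒜] [BorelSpace 𝒜] {Ω : Subshift 𝒜 ℤ}

/-- The mean length `s` of a letter exists uniformly, and is positive. -/
theorem exists_uniform_leftEnd (P : Pieces 𝒜) (hΩ : IsMinimal Ω) (hB : ConditionB Ω) :
    ∃ s > 0, ∀ ε > 0, ∃ C : ℝ, ∀ n : ℕ, ∀ ω ∈ Ω.carrier,
      |leftEnd P ω n - s * n| ≤ ε * n + C := by
  obtain ⟨s, -, hs⟩ := exists_uniform_logCocycle hΩ hB (det_lengthMatrix P)
  have hunif : ∀ ε > 0, ∃ C : ℝ, ∀ n : ℕ, ∀ ω ∈ Ω.carrier,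
      |leftEnd P ω n - s * n| ≤ ε * n + C := by
    intro ε hε
    obtain ⟨C, hC⟩ := hs ε hε
    refine ⟨C + Real.log 2, fun n ω hω => ?_⟩
    have h1 := abs_le.1 (hC n ω hω)
    have h2 := abs_le.1 (abs_logCocycle_lengthMatrix_sub_le P ω n)
    exact abs_le.2 ⟨by linarith, by linarith⟩
  refine ⟨s, ?_, hunif⟩
  obtain ⟨r, hr, _, _, hrS⟩ := exists_length_bounds P
  obtain ⟨ω, hω⟩ := hΩ.1
  obtain ⟨C, hC⟩ := hunif (r / 2) (by positivity)
  by_contra! hs0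
  obtain ⟨n, hn⟩ := exists_nat_gt (2 * C / r)
  rw [div_lt_iff₀ hr] at hn
  have h1 := (abs_le.1 (hC n ω hω)).2
  have h2 := mul_le_leftEnd_natCast (ω := ω) (fun a => (hrS a).1) n
  have h3 : s * n ≤ 0 := mul_nonpos_of_nonpos_of_nonneg hs0 (Nat.cast_nonneg n)
  nlinarith

/-- The growth rate `L` of the transfer matrices is uniform on `Ω`, and the energy is uniformly
hyperbolic unless `L = 0`. -/
theorem exists_uniform_transferMatrix (P : Pieces 𝒜) (hΩ : IsMinimal Ω) (hB : ConditionB Ω)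
    (E : ℝ) :
    ∃ L : ℝ, (∀ ε > 0, ∃ C : ℝ, ∀ ω ∈ Ω.carrier, ∀ x : ℝ, 0 ≤ x →
        |Real.log (opNorm (transferMatrix P E ω x 0)) - L * x| ≤ ε * x + C) ∧
      (L ≠ 0 → E ∈ uniformlyHyperbolic P Ω) := by
  obtain ⟨Λ, hΛ, hunif⟩ := exists_uniform_logCocycle hΩ hB (det_letterMatrix P E)
  obtain ⟨s, hs, hlen⟩ := exists_uniform_leftEnd P hΩ hB
  obtain ⟨r, hr, S, hS, hrS⟩ := exists_length_bounds P
  obtain ⟨D, hD⟩ := exists_pieceSolution_bound P E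
  refine ⟨Λ / s, fun ε hε => ?_, fun hL => ?_⟩
  · set L := Λ / s with hLdef
    have hL0 : 0 ≤ L := by positivity
    obtain ⟨η, hη, hηε⟩ : ∃ η > 0, (1 + L) * η ≤ ε * r :=
      ⟨ε * r / (1 + L), by positivity, by field_simp; exact le_rfl⟩
    obtain ⟨C₁, hC₁⟩ := hunif η hη
    obtain ⟨C₂, hC₂⟩ := hlen η hη
    refine ⟨C₁ + D + L * (C₂ + S), fun ω hω x hx => ?_⟩
    obtain ⟨n, hnx, hxn⟩ := exists_mem_piece_of_nonneg (P := P) (ω := ω) hx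
    have h1 := abs_le.1 (hC₁ n ω hω)
    have h2 := abs_le.1 (hC₂ n ω hω)
    have h3 := abs_log_transferMatrix_sub_le ω hD n hnx hxn.le
    rw [transferMatrix_leftEnd_natCast, ← logCocycle] at h3
    have h3 := abs_le.1 h3
    rw [leftEnd_add_one] at hxn
    have h4 := (hrS (ω n)).2
    have h5 := (mul_le_leftEnd_natCast (ω := ω) (fun a => (hrS a).1) n).trans hnx
    have hΛs : Λ = L * s := by rw [hLdef]; field_simp
    have h6 : L * (x - s * n) ≤ L * (η * n + C₂ + S) := by
      gcongr
      linarith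
    have h7 : L * (s * n - x) ≤ L * (η * n + C₂ + S) := by
      gcongr
      linarith
    have h8 : (1 + L) * η * n ≤ ε * x := by
      calc (1 + L) * η * n ≤ ε * r * n := by gcongr
        _ = ε * (n * r) := by ring
        _ ≤ ε * x := by gcongr
    rw [hΛs] at h1
    exact abs_le.2 ⟨by linarith, by linarith⟩
  · have hΛpos : 0 < Λ := lt_of_le_of_ne hΛ fun h => hL (by rw [← h, zero_div])
    obtain ⟨C, hC⟩ := hunif (Λ / 2) (by positivity)
    refine ⟨Real.exp (-(Λ / 2 + C + D + Real.log 2)), Real.exp_pos _, Λ / 2 / S, by positivity,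
      fun ω hω x => ?_⟩
    have hlog2 : 0 < Real.log 2 := Real.log_pos (by norm_num)
    have key : ∀ n : ℕ, |x| ≤ (n + 1) * S →
        Λ / 2 * n - C - D - Real.log 2 ≤ Real.log (opNorm (transferMatrix P E ω x 0)) →
        Real.exp (-(Λ / 2 + C + D + Real.log 2)) * Real.exp (Λ / 2 / S * |x|) ≤
          opNorm (transferMatrix P E ω x 0) := by
      intro n hn h
      have hpos := one_pos.trans_le (one_le_opNorm_of_det_eq_one (det_transferMatrix P E ω x 0))
      rw [← Real.exp_add, ← Real.le_log_iff_exp_le hpos]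
      have : Λ / 2 / S * |x| ≤ Λ / 2 * (n + 1) := by
        rw [div_mul_eq_mul_div, div_le_iff₀ hS, mul_assoc]
        gcongr
      linarith
    rcases lt_or_ge x 0 with hx | hx
    · obtain ⟨n, hnx, hxn⟩ := exists_mem_piece_of_neg (P := P) (ω := ω) hx
      refine key n ?_ ?_
      · rw [abs_of_neg hx]
        have := neg_leftEnd_neg_le_mul (ω := ω) (fun a => (hrS a).2) n
        linarith
      · have h1 := (abs_le.1 (hC n _ (Ω.mapsTo (-n : ℤ) hω))).1
        have h2 := logCocycle_le_log_transferMatrix_neg (P := P) (E := E) ω n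
        have h3 := (abs_le.1 (abs_log_transferMatrix_sub_le ω hD (-n) hnx hxn)).1
        linarith
    · obtain ⟨n, hnx, hxn⟩ := exists_mem_piece_of_nonneg (P := P) (ω := ω) hx
      refine key n ?_ ?_
      · rw [abs_of_nonneg hx]
        have h : ∀ m : ℕ, leftEnd P ω m ≤ m * S := by
          intro m
          induction m with
          | zero => simp [leftEnd_zero]
          | succ m ih =>
            push_cast
            rw [leftEnd_add_one]
            linarith [(hrS (ω m)).2]
        have := h (n + 1)
        push_cast at this
        linarith
      · have h1 := (abs_le.1 (hC n ω hω)).1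
        have h3 := abs_log_transferMatrix_sub_le ω hD n hnx hxn.le
        rw [transferMatrix_leftEnd_natCast, ← logCocycle] at h3
        linarith [(abs_le.1 h3).1]

end Main

end ContinuumSubshift

open ContinuumSubshift in
theorem propositionp {𝒜 : Type*} [Finite 𝒜] [TopologicalSpace 𝒜] [DiscreteTopology 𝒜]
    [MeasurableSpace 𝒜] [BorelSpace 𝒜]
    (P : ContinuumSubshift.Pieces 𝒜)
    (Ω : SymbolicDynamics.FullShift.Subshift 𝒜 ℤ)
    (hmin : ContinuumSubshift.IsMinimal Ω)
    (hB : ContinuumSubshift.ConditionB Ω)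
    (μ : MeasureTheory.Measure (ℤ → 𝒜))
    (hμ : ContinuumSubshift.IsErgodicMeasure Ω μ) :
    (∀ E : ℝ, ContinuumSubshift.HasLyapunovExponent P μ E
      (ContinuumSubshift.lyapunovExponent P μ E)) ∧
    ContinuumSubshift.zeroSet P μ =
      Set.univ \ ContinuumSubshift.uniformlyHyperbolic P Ω := by
  have := hμ.isProbabilityMeasure
  choose L hL hUH using exists_uniform_transferMatrix P hmin hB
  have hLim : ∀ E, HasLyapunovExponent P μ E (L E) := by
    intro E
    have hae : ∀ᵐ ω ∂μ, ω ∈ Ω.carrier := hμ.carrier_compl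
    filter_upwards [hae] with ω hω
    rw [Metric.tendsto_atTop]
    intro ε hε
    obtain ⟨C, hC⟩ := hL E (ε / 2) (by positivity)
    refine ⟨max 1 (2 * |C| / ε + 1), fun x hx => ?_⟩
    have hx1 : 1 ≤ x := (le_max_left _ _).trans hx
    have hx2 : 2 * |C| / ε < x := by linarith [(le_max_right _ _).trans hx]
    have hx0 : 0 < x := by linarith
    rw [div_lt_iff₀ hε] at hx2
    have h := hC ω hω x hx0.le
    have e : 1 / x * Real.log (opNorm (transferMatrix P E ω x 0)) - L E =
        (Real.log (opNorm (transferMatrix P E ω x 0)) - L E * x) / x := by field_simp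
    rw [Real.dist_eq, e, abs_div, abs_of_pos hx0, div_lt_iff₀ hx0]
    linarith [le_abs_self C]
  have hlyap : ∀ E, HasLyapunovExponent P μ E (lyapunovExponent P μ E) := by
    intro E
    have hex : ∃ l, HasLyapunovExponent P μ E l := ⟨_, hLim E⟩
    rw [lyapunovExponent, dif_pos hex]
    exact hex.choose_spec
  have heq : ∀ E, lyapunovExponent P μ E = L E := by
    intro E
    obtain ⟨ω, h1, h2⟩ := ((hlyap E).and (hLim E)).exists
    exact tendsto_nhds_unique h1 h2
  refine ⟨hlyap, ?_⟩
  ext E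
  simp only [zeroSet, heq, Set.mem_ofPred_eq, Set.mem_sdiff, Set.mem_univ, true_and]
  refine ⟨?_, fun h => by_contra fun h0 => h (hUH E h0)⟩
  rintro h0 ⟨c, hc, γ, hγ, hgrow⟩
  obtain ⟨ω, hω⟩ := hmin.1
  obtain ⟨C, hC⟩ := hL E (γ / 2) (by positivity)
  set x := 2 * (|C| + |Real.log c| + 1) / γ with hx
  have hx0 : 0 ≤ x := by positivity
  have hγx : γ * x = 2 * (|C| + |Real.log c| + 1) := by rw [hx]; field_simp
  have h1 := (abs_le.1 (hC ω hω x hx0)).2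
  have h2 := hgrow ω hω x
  rw [abs_of_nonneg hx0] at h2
  have h3 := Real.log_le_log (by positivity) h2
  rw [Real.log_mul hc.ne' (Real.exp_pos _).ne', Real.log_exp] at h3
  rw [h0] at h1
  linarith [le_abs_self C, neg_abs_le (Real.log c)]
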